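/- **Green correspondence for triangulated categories.** *Conventions.* A subcategory of a triangulated category is *thick* if it is a full triangulated subcategory closed under direct summands; $\mathrm{thick}(\mathcal P)$ is the smallest thick subcategory containing $\mathcal P$. For full subcategories $\mathcal A,\mathcal B$ of an additive category $\mathcal C$, with $\mathcal B$ closed under finite direct sums, $\mathcal A/\mathcal B$ is the category with the objects of $\mathcal A$ and with morphisms those of $\mathcal C$ modulo the morphisms that factor through an object of $\mathcal B$ ($\mathcal B\subseteq\mathcal A$ is not required). For thick $\mathcal B\subseteq\mathcal A$, $\mathcal A_{\mathcal B}$ is the Verdier localisation of $\mathcal A$ at $\mathcal B$, and $L_{\mathcal B}:\mathcal A/\mathcal B\to\mathcal A_{\mathcal B}$ is the canonical functor. Images of subcategories under functors are full subcategories closed under isomorphism. Diagrams commute up to natural isomorphism. *Setting.* Let $\mathcal D,\mathcal H,\mathcal G$ be triangulated categories and let $S':\mathcal D\to\mathcal H$, $T':\mathcal H\to\mathcal D$, $S:\mathcal H\to\mathcal G$, $T:\mathcal G\to\mathcal H$ be triangle functors such that $(S',T')$ and $(S,T)$ are adjoint pairs. Let $\epsilon:\mathrm{id}_{\mathcal H}\to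 TS$ be the unit of $(S,T)$. Assume that there are an endofunctor $U$ of $\mathcal H$ and an isomorphism $TS\cong\mathrm{id}_{\mathcal H}\oplus U$ such that, for the projection $p_1:TS\to\mathrm{id}_{\mathcal H}$, the composite $p_1\circ\epsilon$ is an isomorphism. Let $\mathcal Y$ be a thick subcategory of $\mathcal H$, let $\mathcal Z=(US')^{-1}(\mathcal Y)$ be the full subcategory of the objects $X$ of $\mathcal D$ such that $US'X$ is a direct summand of an object of $\mathcal Y$, and suppose that each object of $TSS'T'\mathcal Y$ is a direct summand of an object of $\mathcal Y$. Put $$\mathcal A=\mathrm{thick}(S'\mathcal Z),\quad \mathcal B=\mathrm{thick}(S'T'\mathcal Y),\quad \mathcal A_1=\mathrm{thick}(SS'\mathcal Z),\quad \mathcal B_1=\mathrm{thick}(SS'T'\mathcal Y),\quad \mathcal A_2=\mathrm{thick}(S'\mathcal Z\cup\mathcal Y)$$ (so $\mathcal A_2=\mathcal A$ when $\mathcal Y\subseteq\mathcal A$). *Conclusions.* One has $\mathcal B\subseteq\mathcal A\subseteq\mathcal A_2$, $\mathcal B\subseteq\mathcal Y\subseteq\mathcal A_2$, $\mathcal B_1\subseteq\mathcal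 A_1$, $S\mathcal A\subseteq\mathcal A_1$, $S\mathcal B\subseteq\mathcal B_1$, $T\mathcal A_1\subseteq\mathcal A_2$ and $T\mathcal B_1\subseteq\mathcal Y$, and: 1. $S$, $T$ and the inclusion $\mathcal A\subseteq\mathcal A_2$ induce triangle functors $$S_Z:\mathcal A_{\mathcal B}\to(\mathcal A_1)_{\mathcal B_1},\qquad T_Z:(\mathcal A_1)_{\mathcal B_1}\to(\mathcal A_2)_{\mathcal Y},\qquad \mathrm{can}:\mathcal A_{\mathcal B}\to(\mathcal A_2)_{\mathcal Y},$$ and there is an isomorphism $T_Z\circ S_Z\cong\mathrm{can}$; if the adjunction $(S,T)$ is compatible with the shifts, then this isomorphism can be chosen to be compatible with the shifts. 2. $S$ and $T$ induce additive functors $S_{\mathrm{thick}}:\mathcal A/\mathcal B\to\mathcal A_1/\mathcal B_1$ and $T_{\mathrm{thick}}:\mathcal A_1/\mathcal B_1\to\mathcal A_2/\mathcal Y$. Let $$\pi_1:S'\mathcal Z/S'T'\mathcal Y\to\mathcal A/\mathcal B,\qquad \pi_2:SS'\mathcal Z/SS'T'\mathcal Y\to\mathcal A_1/\mathcal B_1,\qquad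 \pi_3:S'\mathcal Z/\mathcal Y\to\mathcal A_2/\mathcal Y$$ be the canonical functors. Then the functor $S:S'\mathcal Z/S'T'\mathcal Y\to SS'\mathcal Z/SS'T'\mathcal Y$ induced by $S$ is additive and satisfies $\pi_2\circ S\cong S_{\mathrm{thick}}\circ\pi_1$, and there is an additive functor $T:SS'\mathcal Z/SS'T'\mathcal Y\to S'\mathcal Z/\mathcal Y$ with $\pi_3\circ T\cong T_{\mathrm{thick}}\circ\pi_2$. Moreover $S_{\mathrm{thick}}$ restricts to an equivalence from the image of $\pi_1$ to the image of $\pi_2$, and $T_{\mathrm{thick}}$ restricts to an equivalence from the image of $\pi_2$ to the image of $\pi_3$. 3. The full subcategories of $\mathcal A_{\mathcal B}$, $(\mathcal A_1)_{\mathcal B_1}$, $(\mathcal A_2)_{\mathcal Y}$ on the images of $L_{\mathcal B}\circ\pi_1$, $L_{\mathcal B_1}\circ\pi_2$, $L_{\mathcal Y}\circ\pi_3$ are additive categories. The functors $S_Z$, $T_Z$ and $\mathrm{can}$ restrict to functors $S_L$, $T_L$, $\mathrm{can}_L$ between these subcategories; $S_L$ and $T_L$ are equivalences of additive categories, and $T_L\circ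 S_L\cong\mathrm{can}_L$. 4. If $S_{\mathrm{thick}}:\mathcal A/\mathcal B\to\mathcal A_1/\mathcal B_1$ and $T_{\mathrm{thick}}:\mathcal A_1/\mathcal B_1\to\mathcal A_2/\mathcal Y$ are equivalences, then $S_Z$ and $T_Z$ are equivalences of triangulated categories, and they are mutually inverse up to the identification $\mathrm{can}$: the functor $\mathrm{can}$ is an equivalence, and $\mathrm{can}^{-1}\circ T_Z$ is inverse to $S_Z$. -/

import Mathlib

open CategoryTheory Limits Pretriangulated Triangulated ZeroObject

namespace Green

universe v₁ v₂ u₁ u₂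

section Restrict

variable {C : Type u₁} [Category.{v₁} C] {C' : Type u₂} [Category.{v₂} C']

lemma prop_restrict (F : C ⥤ C') {P : ObjectProperty C} {Q : ObjectProperty C'}
    (h : P ≤ Q.inverseImage F) (X : P.FullSubcategory) : Q ((P.ι ⋙ F).obj X) :=
  h _ X.property

/-- The restriction of a functor to full subcategories. -/
abbrev restrict (F : C ⥤ C') (P : ObjectProperty C) (Q : ObjectProperty C')
    (h : P ≤ Q.inverseImage F) : P.FullSubcategory ⥤ Q.FullSubcategory :=
  Q.lift (P.ι ⋙ F) (prop_restrict F h)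

end Restrict

section Additive

variable {C : Type u₁} [Category.{v₁} C] [Preadditive C] [HasFiniteBiproducts C]
variable {C' : Type u₂} [Category.{v₂} C'] [Preadditive C'] [HasFiniteBiproducts C']

/-- The image of a class of objects which is closed under finite direct sums under an additive
functor (closed under isomorphisms) is closed under finite direct sums. -/
instance isClosedUnderFiniteProducts_map (P : ObjectProperty C) [P.IsClosedUnderFiniteProducts]
    (F : C ⥤ C') [F.Additive] : (P.map F).IsClosedUnderFiniteProducts where
  isClosedUnderLimitsOfShape J _ := by
    refine ⟨?_⟩
    rintro Z ⟨p⟩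
    have hp : ∀ j : J, ∃ X : C, P X ∧ Nonempty (F.obj X ≅ p.diag.obj ⟨j⟩) :=
      fun j => p.prop_diag_obj ⟨j⟩
    choose X hX e using hp
    have : PreservesFiniteProducts F := inferInstance
    have : HasFiniteProducts C := inferInstance
    have : PreservesLimitsOfShape (Discrete J) F := inferInstance
    refine ⟨∏ᶜ X, P.prop_product hX, ⟨?_⟩⟩
    refine IsLimit.conePointsIsoOfNatIso
      (isLimitOfPreserves F (limit.isLimit (Discrete.functor X))) p.isLimit
      (Discrete.natIso (fun j => (e j.as).some))

/-- Two morphisms of the full subcategory `A` of `C` are identified if their difference factors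
in `C` through an object of `B`. It is not required that `B` is contained in `A`. -/
def factorRel (A B : ObjectProperty C) : HomRel A.FullSubcategory :=
  fun X Y f g => ∃ (W : C) (_ : B W) (a : X.obj ⟶ W) (b : W ⟶ Y.obj), f.hom - g.hom = a ≫ b

instance (A B : ObjectProperty C) [B.IsClosedUnderFiniteProducts] :
    Congruence (factorRel A B) where
  comp_left := by
    rintro X Y Z f g g' ⟨W, hW, a, b, h⟩
    refine ⟨W, hW, f.hom ≫ a, b, ?_⟩
    simp [← h]
  comp_right := by
    rintro X Y Z f f' g ⟨W, hW, a, b, h⟩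
    refine ⟨W, hW, a, b ≫ g.hom, ?_⟩
    rw [← Category.assoc, ← h]
    simp
  equivalence :=
    { refl := fun f => ⟨⊤_ C, B.prop_terminal, 0, 0, by simp⟩
      symm := by
        rintro f g ⟨W, hW, a, b, h⟩
        exact ⟨W, hW, -a, b, by rw [Preadditive.neg_comp, ← h, neg_sub]⟩
      trans := by
        have := HasBinaryBiproducts.of_hasBinaryProducts (C := C)
        rintro f g k ⟨W, hW, a, b, h⟩ ⟨W', hW', a', b', h'⟩
        refine ⟨W ⊞ W', ?_, biprod.lift a a', biprod.desc b b', ?_⟩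
        · exact B.prop_of_isLimit_binaryFan (BinaryBiproduct.isLimit W W') hW hW'
        · rw [biprod.lift_desc, ← h, ← h']
          abel }

lemma factorRel_add (A B : ObjectProperty C) [B.IsClosedUnderFiniteProducts]
    ⦃X Y : A.FullSubcategory⦄ (f₁ f₂ g₁ g₂ : X ⟶ Y) (hf : factorRel A B f₁ f₂)
    (hg : factorRel A B g₁ g₂) : factorRel A B (f₁ + g₁) (f₂ + g₂) := by
  have := HasBinaryBiproducts.of_hasBinaryProducts (C := C)
  obtain ⟨W, hW, a, b, h⟩ := hf
  obtain ⟨W', hW', a', b', h'⟩ := hg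
  refine ⟨W ⊞ W', ?_, biprod.lift a a', biprod.desc b b', ?_⟩
  · exact B.prop_of_isLimit_binaryFan (BinaryBiproduct.isLimit W W') hW hW'
  · change (f₁.hom + g₁.hom) - (f₂.hom + g₂.hom) = _
    rw [biprod.lift_desc, ← h, ← h']
    abel

/-- The additive quotient `A / B`: its objects are those of `A`, and its morphisms are those of
`C` modulo the morphisms factoring through an object of `B`. -/
abbrev AddQuot (A B : ObjectProperty C) : Type u₁ := CategoryTheory.Quotient (factorRel A B)

instance (A B : ObjectProperty C) [B.IsClosedUnderFiniteProducts] : Preadditive (AddQuot A B) :=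
  CategoryTheory.Quotient.preadditive _ (factorRel_add A B)

/-- The projection functor from `A` to `A / B`. -/
abbrev AddQuot.proj (A B : ObjectProperty C) : A.FullSubcategory ⥤ AddQuot A B :=
  CategoryTheory.Quotient.functor (factorRel A B)

/-- The functor `A / B ⥤ A' / B'` induced by an additive functor `F` which maps `A` to `A'` and
`B` to `B'`: on objects and on representatives of morphisms it is given by `F`. -/
def AddQuot.map (F : C ⥤ C') [F.Additive] {A B : ObjectProperty C} {A' B' : ObjectProperty C'}
    (hA : A ≤ A'.inverseImage F) (hB : B ≤ B'.inverseImage F) :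
    AddQuot A B ⥤ AddQuot A' B' :=
  CategoryTheory.Quotient.lift _ (restrict F A A' hA ⋙ AddQuot.proj A' B') (by
    rintro X Y f g ⟨W, hW, a, b, h⟩
    refine CategoryTheory.Quotient.sound _ ⟨F.obj W, hB W hW, F.map a, F.map b, ?_⟩
    rw [← F.map_comp, ← h, F.map_sub]
    rfl)

end Additive

section Triangulated

variable {C : Type u₁} [Category.{v₁} C] [HasZeroObject C] [HasShift C ℤ] [Preadditive C]
  [∀ n : ℤ, (shiftFunctor C n).Additive] [Pretriangulated C]
variable {C' : Type u₂} [Category.{v₂} C'] [HasZeroObject C'] [HasShift C' ℤ] [Preadditive C']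
  [∀ n : ℤ, (shiftFunctor C' n).Additive] [Pretriangulated C']

/-- The thick closure of `P`: the intersection of all thick subcategories (triangulated and closed
under direct summands) which contain `P`. -/
def thick (P : ObjectProperty C) : ObjectProperty C := fun X =>
  ∀ Q : ObjectProperty C, Q.IsTriangulated → Q.IsStableUnderRetracts → P ≤ Q → Q X

instance (P : ObjectProperty C) : (thick P).IsStableUnderRetracts where
  of_retract r h Q hQ hQ' hP := hQ'.of_retract r (h Q hQ hQ' hP)

instance (P : ObjectProperty C) : (thick P).IsTriangulated where
  exists_zero := ⟨0, isZero_zero C, fun Q _ _ _ => Q.prop_zero⟩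
  isStableUnderShiftBy n :=
    { le_shift := fun X h Q hQ hQ' hP => Q.le_shift n X (h Q hQ hQ' hP) }
  toIsTriangulatedClosed₂ := .mk' (fun T hT h₁ h₃ Q hQ hQ' hP =>
    Q.ext_of_isTriangulatedClosed₂ T hT (h₁ Q hQ hQ' hP) (h₃ Q hQ hQ' hP))

variable [IsTriangulated C] [IsTriangulated C']

/-- The Verdier localisation `A_B` of the triangulated subcategory `A` at the triangulated
subcategory `B`: the localisation of `A` at the morphisms whose cone belongs to `B`. (It is only
used for `B` contained in `A`.) -/
abbrev Verdier (A B : ObjectProperty C) [A.IsTriangulated] : Type u₁ :=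
  (B.inverseImage A.ι).trW.Localization

/-- The localisation functor from `A` to `A_B`. -/
abbrev Verdier.proj (A B : ObjectProperty C) [A.IsTriangulated] :
    A.FullSubcategory ⥤ Verdier A B :=
  (B.inverseImage A.ι).trW.Q

/-- A triangle functor `F` mapping `A` to `A'` and `B` to `B'` maps morphisms in `A` with cone
in `B` to morphisms in `A'` with cone in `B'`. -/
def Verdier.localizerMorphism (F : C ⥤ C') [F.CommShift ℤ] [F.IsTriangulated]
    {A B : ObjectProperty C} {A' B' : ObjectProperty C'} [A.IsTriangulated] [A'.IsTriangulated]
    (hA : A ≤ A'.inverseImage F) (hB : B ≤ B'.inverseImage F) :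
    LocalizerMorphism (B.inverseImage A.ι).trW (B'.inverseImage A'.ι).trW where
  functor := restrict F A A' hA
  map := by
    rintro X Y f ⟨Z, g, h, hT, hZ⟩
    exact ⟨_, _, _, (restrict F A A' hA).map_distinguished _ hT,
      hB _ hZ⟩

noncomputable instance (F : C ⥤ C') [F.CommShift ℤ] [F.IsTriangulated]
    {A B : ObjectProperty C} {A' B' : ObjectProperty C'} [A.IsTriangulated] [A'.IsTriangulated]
    (hA : A ≤ A'.inverseImage F) (hB : B ≤ B'.inverseImage F) :
    (Verdier.localizerMorphism F hA hB).functor.CommShift ℤ :=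
  inferInstanceAs ((restrict F A A' hA).CommShift ℤ)

/-- The functor `A_B ⥤ A'_{B'}` induced by a triangle functor `F` which maps `A` to `A'` and `B` to
`B'`, obtained from the universal property of the localisation. -/
noncomputable def Verdier.map (F : C ⥤ C') [F.CommShift ℤ] [F.IsTriangulated]
    {A B : ObjectProperty C} {A' B' : ObjectProperty C'} [A.IsTriangulated] [A'.IsTriangulated]
    (hA : A ≤ A'.inverseImage F) (hB : B ≤ B'.inverseImage F) :
    Verdier A B ⥤ Verdier A' B' :=
  (Verdier.localizerMorphism F hA hB).localizedFunctor (Verdier.proj A B) (Verdier.proj A' B')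

/-- The commutation of the induced functor with the shifts, induced by that of `F`. -/
noncomputable instance Verdier.commShiftMap (F : C ⥤ C') [F.CommShift ℤ] [F.IsTriangulated]
    {A B : ObjectProperty C} {A' B' : ObjectProperty C'} [A.IsTriangulated] [A'.IsTriangulated]
    [B.IsTriangulated] [B.IsClosedUnderIsomorphisms]
    [B'.IsTriangulated] [B'.IsClosedUnderIsomorphisms]
    (hA : A ≤ A'.inverseImage F) (hB : B ≤ B'.inverseImage F) :
    (Verdier.map F hA hB).CommShift ℤ :=
  inferInstanceAs (((Verdier.localizerMorphism F hA hB).localizedFunctor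
    (Verdier.proj A B) (Verdier.proj A' B')).CommShift ℤ)

/-- The canonical functor `A / B ⥤ A_B` from the additive quotient to the Verdier localisation. -/
noncomputable def canL (A B : ObjectProperty C) [A.IsTriangulated] [B.IsTriangulated]
    [B.IsClosedUnderIsomorphisms] (hBA : B ≤ A) : AddQuot A B ⥤ Verdier A B :=
  CategoryTheory.Quotient.lift _ (Verdier.proj A B) (by
    rintro X Y f g ⟨W, hW, a, b, h⟩
    let W' : A.FullSubcategory := ⟨W, hBA W hW⟩
    have hz : IsZero ((Verdier.proj A B).obj W') := by
      have hiso : IsIso ((Verdier.proj A B).map (0 : W' ⟶ 0)) := by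
        refine Localization.inverts _ (B.inverseImage A.ι).trW _ ?_
        rw [ObjectProperty.trW_iff']
        exact ⟨W', 𝟙 W', 0, contractible_distinguished W', hW⟩
      exact IsZero.of_iso ((isZero_zero _))
        (asIso ((Verdier.proj A B).map (0 : W' ⟶ 0)) ≪≫ (Verdier.proj A B).mapZeroObject)
    have hfg : f - g = (A.homMk a : X ⟶ W') ≫ (A.homMk b : W' ⟶ Y) := by
      ext
      exact h
    rw [← sub_eq_zero, ← Functor.map_sub, hfg, Functor.map_comp, hz.eq_zero_of_tgt
      ((Verdier.proj A B).map (A.homMk a : X ⟶ W')), zero_comp])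

end Triangulated

end Green

/-!
The unit `ε : 𝟭 ⟶ TS` of the adjunction `S ⊣ T` is the whole source of the correspondence. Because
`TS ≅ 𝟭 ⊞ U` with `ε` split along the first summand, `ε` at `X` is a split monomorphism whose
complementary idempotent factors through `U X` (`exists_retraction_unit`). For `X` in `S'Z` the
object `U X` lies in `Y`, so `ε` is invertible at `X` modulo `Y` (`AddQuot.isIso_proj_map`). The
objects at which a transformation of triangle functors is invertible form a thick subcategory
(`isIso_app_of_thick`), so `ε` becomes invertible in the Verdier localisation `(A₂)_Y` at every
object of `A = thick S'Z`, and `can ≅ T_Z S_Z` (`Verdier.exists_iso_map`). This argument needs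
shifts on `T` compatible with `ε`; the ones transported from `S` along the adjunction serve, and
the functors underlying `T_Z` and `can` do not depend on that choice.

The second ingredient is that a morphism from `S' z` to an object `W` of `Y` factors through
`S' T' W`, hence through `B` (`exists_factorization_of_leftAdjoint`). This implies that morphisms
with source in `S'Z` are the same modulo `B` and modulo `Y`, and that `T` is faithful on morphisms
with source `S X` for `X` in `S'Z`. In the additive quotients both are direct
(`AddQuot.map_id_bijective`, `AddQuot.map_rightAdjoint_injective`). In the Verdier localisations
morphisms are fractions, and the factorisation property allows one to choose denominators coming
from `A` (`exists_refinement`), which reduces them to the same computation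
(`Verdier.map_id_bijective`, `Verdier.map_rightAdjoint_injective`). From the invertibility of `ε`,
the full faithfulness of `can` and the faithfulness of `T` it is formal that `S` and `T` restrict to
equivalences between the images (`restrict_essImage_isEquivalence`).

Finally, `A → A_B` inverts exactly the morphisms with cone in `B`, and a cone lies in `B` exactly
when it is zero in `A / B`. So the canonical functor `A / B ⥤ A_B` is a localisation at a class of
morphisms which any functor inducing an equivalence of additive quotients preserves and reflects,
and such a functor induces an equivalence of Verdier localisations (`Verdier.map_isEquivalence`).
-/

namespace Green

universe v₁ v₂ u₁ u₂

/-! ### Thick closures and the functors induced on quotients -/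

section

variable {C : Type u₁} [Category.{v₁} C] [HasZeroObject C] [HasShift C ℤ] [Preadditive C]
  [∀ n : ℤ, (shiftFunctor C n).Additive] [Pretriangulated C]

lemma le_thick (P : ObjectProperty C) : P ≤ thick P := fun _ hX _ _ _ h => h _ hX

lemma thick_le {P Q : ObjectProperty C} [Q.IsTriangulated] [Q.IsStableUnderRetracts]
    (h : P ≤ Q) : thick P ≤ Q := fun _ hX => hX Q inferInstance inferInstance h

end

instance isStableUnderRetracts_inverseImage {C : Type u₁} [Category.{v₁} C] {C' : Type u₂}
    [Category.{v₂} C'] (F : C ⥤ C') (Q : ObjectProperty C') [Q.IsStableUnderRetracts] :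
    (Q.inverseImage F).IsStableUnderRetracts where
  of_retract r h := Q.prop_of_retract (r.map F) h

section

variable {C : Type u₁} [Category.{v₁} C] [HasZeroObject C] [HasShift C ℤ] [Preadditive C]
  [∀ n : ℤ, (shiftFunctor C n).Additive] [Pretriangulated C] [IsTriangulated C]
variable {C' : Type u₂} [Category.{v₂} C'] [HasZeroObject C'] [HasShift C' ℤ] [Preadditive C']
  [∀ n : ℤ, (shiftFunctor C' n).Additive] [Pretriangulated C'] [IsTriangulated C']
variable {A B : ObjectProperty C} {A' B' : ObjectProperty C'} [A.IsTriangulated]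
  [A'.IsTriangulated] [B.IsTriangulated] [B'.IsTriangulated]

lemma Verdier.isZero_proj_obj [B.IsClosedUnderIsomorphisms] (X : A.FullSubcategory)
    (hX : B X.obj) : IsZero ((Verdier.proj A B).obj X) := by
  have : IsIso ((Verdier.proj A B).map (0 : X ⟶ 0)) := by
    refine Localization.inverts _ (B.inverseImage A.ι).trW _ ?_
    rw [ObjectProperty.trW_iff']
    exact ⟨X, 𝟙 X, 0, contractible_distinguished X, hX⟩
  exact IsZero.of_iso (isZero_zero _)
    (asIso ((Verdier.proj A B).map (0 : X ⟶ 0)) ≪≫ (Verdier.proj A B).mapZeroObject)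

/-- The kernel of the localisation functor at a thick subcategory `B` is `B`. -/
lemma Verdier.isZero_proj_obj_iff [B.IsStableUnderRetracts] (X : A.FullSubcategory) :
    IsZero ((Verdier.proj A B).obj X) ↔ B X.obj := by
  refine ⟨fun h => ?_, Verdier.isZero_proj_obj X⟩
  have h0 : (Verdier.proj A B).map (𝟙 X) = (Verdier.proj A B).map 0 := h.eq_of_src _ _
  rw [MorphismProperty.map_eq_iff_postcomp _ (B.inverseImage A.ι).trW] at h0
  obtain ⟨Z, s, ⟨W, g, h, hT, hW⟩, hs⟩ := h0
  -- a morphism with cone `W` which vanishes splits off the shift of its source from `W`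
  obtain rfl : s = 0 := by simpa using hs
  obtain ⟨j, hj⟩ := Triangle.coyoneda_exact₁ _ hT (𝟙 (X⟦(1 : ℤ)⟧))
    (by
      change 𝟙 _ ≫ (shiftFunctor _ (1 : ℤ)).map (0 : X ⟶ Z) = 0
      rw [Functor.map_zero, comp_zero])
  have h1 : (B.inverseImage A.ι) (X⟦(1 : ℤ)⟧) :=
    ObjectProperty.prop_of_retract _ ⟨j, h, hj.symm⟩ hW
  exact ((B.inverseImage A.ι).prop_shift_iff_of_isStableUnderShift X 1).1 h1

/-- For thick `B`, the multiplicative system of morphisms with cone in `B` is saturated. -/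
lemma Verdier.isIso_proj_map_iff [B.IsStableUnderRetracts] {X Y : A.FullSubcategory} (f : X ⟶ Y) :
    IsIso ((Verdier.proj A B).map f) ↔ (B.inverseImage A.ι).trW f := by
  refine ⟨fun h => ?_, fun h => Localization.inverts _ (B.inverseImage A.ι).trW _ h⟩
  obtain ⟨Z, g, k, hT⟩ := distinguished_cocone_triangle f
  exact ⟨Z, g, k, hT, (Verdier.isZero_proj_obj_iff Z).1
    ((Triangle.isZero₃_iff_isIso₁ _ ((Verdier.proj A B).map_distinguished _ hT)).2 h)⟩

section Map

variable [B.IsClosedUnderIsomorphisms] [B'.IsClosedUnderIsomorphisms]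
  (F : C ⥤ C') [F.CommShift ℤ] [F.IsTriangulated]
    (hA : A ≤ A'.inverseImage F) (hB : B ≤ B'.inverseImage F)

/-- The functor induced by `F` on the localisations commutes with the localisation functors. -/
noncomputable def Verdier.projCompMap :
    Verdier.proj A B ⋙ Verdier.map F hA hB ≅ restrict F A A' hA ⋙ Verdier.proj A' B' :=
  Localization.Lifting.iso (Verdier.proj A B) (B.inverseImage A.ι).trW
    ((Verdier.localizerMorphism F hA hB).functor ⋙ Verdier.proj A' B')
    ((Verdier.localizerMorphism F hA hB).localizedFunctor (Verdier.proj A B) (Verdier.proj A' B'))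

instance : NatTrans.CommShift (Verdier.projCompMap F hA hB).inv ℤ :=
  inferInstanceAs (NatTrans.CommShift (CatCommSq.iso (Verdier.localizerMorphism F hA hB).functor
   (Verdier.proj A B) (Verdier.proj A' B') ((Verdier.localizerMorphism F hA hB).localizedFunctor
   (Verdier.proj A B) (Verdier.proj A' B'))).hom ℤ)

instance : NatTrans.CommShift (Verdier.projCompMap F hA hB).hom ℤ :=
  have : NatTrans.CommShift (Verdier.projCompMap F hA hB).symm.hom ℤ :=
    inferInstanceAs (NatTrans.CommShift (Verdier.projCompMap F hA hB).inv ℤ)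
  NatTrans.CommShift.of_iso_inv (Verdier.projCompMap F hA hB).symm ℤ

instance : (Verdier.map F hA hB).IsTriangulated := by
  have := Localization.essSurj_mapArrow (Verdier.proj A B) (B.inverseImage A.ι).trW
  exact Functor.isTriangulated_of_precomp_iso (Verdier.projCompMap F hA hB)

/-- The functors induced by `F` on the additive quotients and on the localisations commute with the
canonical functors. -/
noncomputable def canLCompMap (hBA : B ≤ A) (hBA' : B' ≤ A') :
    canL A B hBA ⋙ Verdier.map F hA hB ≅ AddQuot.map F hA hB ⋙ canL A' B' hBA' :=
  Quotient.natIsoLift _ (Verdier.projCompMap F hA hB)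

end Map

instance canL_additive [B.IsClosedUnderIsomorphisms] (hBA : B ≤ A) : (canL A B hBA).Additive where
  map_add {X Y f g} := by
    obtain ⟨f, rfl⟩ := (AddQuot.proj A B).map_surjective f
    obtain ⟨g, rfl⟩ := (AddQuot.proj A B).map_surjective g
    exact (Verdier.proj A B).map_add

end

instance AddQuot.map_additive {C : Type u₁} [Category.{v₁} C] [Preadditive C]
    [HasFiniteBiproducts C] {C' : Type u₂} [Category.{v₂} C'] [Preadditive C']
    [HasFiniteBiproducts C'] (F : C ⥤ C') [F.Additive] {A B : ObjectProperty C}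
    {A' B' : ObjectProperty C'} [B.IsClosedUnderFiniteProducts] [B'.IsClosedUnderFiniteProducts]
    (hA : A ≤ A'.inverseImage F) (hB : B ≤ B'.inverseImage F) :
    (AddQuot.map F hA hB).Additive where
  map_add {X Y f g} := by
    obtain ⟨f, rfl⟩ := (AddQuot.proj A B).map_surjective f
    obtain ⟨g, rfl⟩ := (AddQuot.proj A B).map_surjective g
    exact congrArg (AddQuot.proj A' B').map ((restrict F A A' hA).map_add (f := f) (g := g))

/-! ### The Verdier localisation as a localisation of the additive quotient -/

/-- For `B` closed under direct summands, the objects vanishing in `A / B` are those in `B`: an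
identity factoring through `W` exhibits a summand of `W`. -/
lemma AddQuot.isZero_proj_obj_iff {C : Type u₁} [Category.{v₁} C] [Preadditive C]
    [HasFiniteBiproducts C] {A B : ObjectProperty C} [B.IsClosedUnderFiniteProducts]
    [B.IsStableUnderRetracts] (X : A.FullSubcategory) :
    IsZero ((AddQuot.proj A B).obj X) ↔ B X.obj := by
  rw [IsZero.iff_id_eq_zero]
  have h : 𝟙 ((AddQuot.proj A B).obj X) = 0 ↔ factorRel A B (𝟙 X) 0 :=
    CategoryTheory.Quotient.functor_map_eq_iff (factorRel A B) (𝟙 X) 0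
  rw [h]
  constructor
  · rintro ⟨W, hW, a, b, h⟩
    exact B.prop_of_retract ⟨a, b, by rw [← h]; exact sub_zero _⟩ hW
  · exact fun hX => ⟨X.obj, hX, 𝟙 _, 𝟙 _, by rw [Category.comp_id]; exact sub_zero _⟩

section

variable {C : Type u₁} [Category.{v₁} C] [HasZeroObject C] [HasShift C ℤ] [Preadditive C]
  [∀ n : ℤ, (shiftFunctor C n).Additive] [Pretriangulated C] [IsTriangulated C]
variable {C' : Type u₂} [Category.{v₂} C'] [HasZeroObject C'] [HasShift C' ℤ] [Preadditive C']
  [∀ n : ℤ, (shiftFunctor C' n).Additive] [Pretriangulated C'] [IsTriangulated C']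
variable {A B : ObjectProperty C} {A' B' : ObjectProperty C'} [A.IsTriangulated]
  [A'.IsTriangulated] [B.IsTriangulated] [B'.IsTriangulated]

/-- The morphisms of `A / B` which become invertible in `A_B`. -/
def canLIso [B.IsClosedUnderIsomorphisms] (hBA : B ≤ A) : MorphismProperty (AddQuot A B) :=
  (MorphismProperty.isomorphisms _).inverseImage (canL A B hBA)

instance [B.IsClosedUnderIsomorphisms] (hBA : B ≤ A) : (canLIso hBA).RespectsIso :=
  inferInstanceAs ((MorphismProperty.isomorphisms _).inverseImage (canL A B hBA)).RespectsIso

/-- A functor on `A / B` inverting the morphisms that become invertible in `A_B` induces a functor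
on `A` inverting the morphisms with cone in `B`. -/
lemma isInvertedBy_proj_comp [B.IsClosedUnderIsomorphisms] {hBA : B ≤ A} {E : Type*} [Category* E]
    {G : AddQuot A B ⥤ E} (hG : (canLIso hBA).IsInvertedBy G) :
    (B.inverseImage A.ι).trW.IsInvertedBy (AddQuot.proj A B ⋙ G) := fun _ _ f hf =>
  hG _ (Localization.inverts (Verdier.proj A B) (B.inverseImage A.ι).trW f hf)

/-- The universal property of `canL` as a strict localisation: functors out of `A / B` inverting
`canLIso` are functors out of `A` inverting the morphisms with cone in `B`. -/
noncomputable def canLUniv [B.IsClosedUnderIsomorphisms] (hBA : B ≤ A) (E : Type*) [Category* E] :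
    Localization.StrictUniversalPropertyFixedTarget (canL A B hBA) (canLIso hBA) E where
  inverts _ _ _ hf := hf
  lift G hG := Localization.Construction.lift (AddQuot.proj A B ⋙ G) (isInvertedBy_proj_comp hG)
  fac G hG := CategoryTheory.Quotient.lift_unique' _ _ _ (Localization.Construction.fac
    (W := (B.inverseImage A.ι).trW) (AddQuot.proj A B ⋙ G)
    (isInvertedBy_proj_comp hG))
  uniq _ _ h := Localization.Construction.uniq _ _
    (congrArg (fun K => AddQuot.proj A B ⋙ K) h)

instance canL_isLocalization [B.IsClosedUnderIsomorphisms] (hBA : B ≤ A) :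
    (canL A B hBA).IsLocalization (canLIso hBA) :=
  Functor.IsLocalization.mk' _ _ (canLUniv hBA _) (canLUniv hBA _)

/-- If a triangle functor induces an equivalence between the additive quotients, then it induces an
equivalence between the Verdier localisations. -/
theorem Verdier.map_isEquivalence [B.IsStableUnderRetracts] [B'.IsStableUnderRetracts]
    (F : C ⥤ C') [F.CommShift ℤ] [F.IsTriangulated]
    (hA : A ≤ A'.inverseImage F) (hB : B ≤ B'.inverseImage F) (hBA : B ≤ A) (hBA' : B' ≤ A')
    (h : (AddQuot.map F hA hB).IsEquivalence) : (Verdier.map F hA hB).IsEquivalence := by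
  -- the functor preserves and reflects the vanishing of cones modulo `B` and `B'`
  have key : ∀ ⦃X Y : AddQuot A B⦄ (f : X ⟶ Y),
    canLIso hBA' ((AddQuot.map F hA hB).map f) ↔ canLIso hBA f := by
    intro X Y f
    obtain ⟨f, rfl⟩ := (AddQuot.proj A B).map_surjective f
    obtain ⟨Z, g, k, hT⟩ := distinguished_cocone_triangle f
    have h₁ := (Verdier.isIso_proj_map_iff f).trans
      ((B.inverseImage A.ι).trW_iff_of_distinguished _ hT)
    have h₂ := (Verdier.isIso_proj_map_iff (B := B') ((restrict F A A' hA).map f)).trans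
      ((B'.inverseImage A'.ι).trW_iff_of_distinguished _
        ((restrict F A A' hA).map_distinguished _ hT))
    refine h₂.trans (Iff.trans ?_ h₁.symm)
    refine ⟨fun hZ => (AddQuot.isZero_proj_obj_iff (A := A) (B := B) Z).1 ?_, fun hZ => hB _ hZ⟩
    have hZ' := (AddQuot.isZero_proj_obj_iff (A := A') (B := B') _).2 hZ
    rw [IsZero.iff_id_eq_zero]
    exact (AddQuot.map F hA hB).map_injective (hZ'.eq_of_src _ _)
  let Φ : LocalizerMorphism (canLIso hBA) (canLIso hBA') :=
    { functor := AddQuot.map F hA hB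
      map := fun _ _ f hf => (key f).2 hf }
  have : Φ.functor.IsEquivalence := h
  have : Φ.IsInduced := ⟨by ext X Y f; exact key f⟩
  have := Φ.isLocalizedEquivalence_of_isInduced
  have : CatCommSq Φ.functor (canL A B hBA) (canL A' B' hBA') (Verdier.map F hA hB) :=
    ⟨(canLCompMap F hA hB hBA hBA').symm⟩
  exact Φ.isEquivalence (canL A B hBA) (canL A' B' hBA') _

end

/-! ### The unit of an adjunction on Verdier localisations -/

section Unit

variable {C : Type u₁} [Category.{v₁} C] {C' : Type u₂} [Category.{v₂} C']

/-- The restriction of the unit of an adjunction to full subcategories. -/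
def unitRestrict {S : C ⥤ C'} {T : C' ⥤ C} (adj : S ⊣ T) {A A₂ : ObjectProperty C}
    {A₁ : ObjectProperty C'} (hA : A ≤ A₂.inverseImage (𝟭 C)) (hS : A ≤ A₁.inverseImage S)
    (hT : A₁ ≤ A₂.inverseImage T) :
    restrict (𝟭 C) A A₂ hA ⟶ restrict S A A₁ hS ⋙ restrict T A₁ A₂ hT where
  app X := A₂.homMk (adj.unit.app X.obj)
  naturality X Y f := by
    ext
    exact adj.unit.naturality f.hom

end Unit

section Shift

variable {C₁ C₂ C₃ : Type*} [Category* C₁] [Category* C₂] [Category* C₃]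
  {M : Type*} [AddMonoid M] [HasShift C₁ M] [HasShift C₂ M] [HasShift C₃ M]

/-- Compatibility with the shifts may be checked after composition with a faithful functor. -/
lemma commShift_of_whiskerRight {F₁ F₂ : C₁ ⥤ C₂} (τ : F₁ ⟶ F₂) [F₁.CommShift M]
    [F₂.CommShift M] (G : C₂ ⥤ C₃) [G.CommShift M] [G.Faithful]
    [NatTrans.CommShift (Functor.whiskerRight τ G) M] : NatTrans.CommShift τ M where
  shift_comm a := by
    ext X
    apply G.map_injective
    have h := NatTrans.shift_app_comm (Functor.whiskerRight τ G) a X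
    simp only [Functor.commShiftIso_comp_hom_app, Functor.whiskerRight_app, Category.assoc] at h
    have h' := (G.commShiftIso a).hom.naturality (τ.app X)
    dsimp at h' ⊢
    rw [← h', ← Category.assoc, ← Category.assoc, cancel_mono] at h
    simpa using h

/-- Compatibility with the shifts may be checked after precomposition with a localisation
functor. -/
lemma commShift_of_whiskerLeft_localization (L : C₁ ⥤ C₂) (W : MorphismProperty C₁)
    [L.IsLocalization W] [L.CommShift M] {F₁ F₂ : C₂ ⥤ C₃} (τ : F₁ ⟶ F₂) [F₁.CommShift M]
    [F₂.CommShift M]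
    [NatTrans.CommShift (Functor.whiskerLeft L τ) M] : NatTrans.CommShift τ M where
  shift_comm a := by
    apply Localization.natTrans_ext L W
    intro X
    have h := NatTrans.shift_app_comm (Functor.whiskerLeft L τ) a X
    simp only [Functor.commShiftIso_comp_hom_app, Functor.whiskerLeft_app, Category.assoc] at h
    dsimp at h ⊢
    rw [← τ.naturality_assoc, cancel_epi] at h
    exact h

instance {A : ObjectProperty C₁} [A.IsStableUnderShift M] {A₂ : ObjectProperty C₁}
    [A₂.IsStableUnderShift M] {A₁ : ObjectProperty C₂} [A₁.IsStableUnderShift M]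
    {S : C₁ ⥤ C₂} {T : C₂ ⥤ C₁} [S.CommShift M] [T.CommShift M] (adj : S ⊣ T) [adj.CommShift M]
    (hA : A ≤ A₂.inverseImage (𝟭 C₁)) (hS : A ≤ A₁.inverseImage S)
    (hT : A₁ ≤ A₂.inverseImage T) : NatTrans.CommShift (unitRestrict adj hA hS hT) M := by
  have h : Functor.whiskerRight (unitRestrict adj hA hS hT) A₂.ι =
      (A₂.liftCompιIso (A.ι ⋙ 𝟭 _) _).hom ≫ Functor.whiskerLeft A.ι adj.unit ≫
      (Functor.associator A.ι S T).inv ≫ Functor.whiskerRight (A₁.liftCompιIso (A.ι ⋙ S) _).inv T ≫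
      (Functor.associator _ A₁.ι T).hom ≫
      Functor.whiskerLeft (restrict S A A₁ hS) (A₂.liftCompιIso (A₁.ι ⋙ T) _).inv ≫
      (Functor.associator _ (restrict T A₁ A₂ hT) A₂.ι).inv := by
    ext X
    change adj.unit.app X.obj =
      𝟙 _ ≫ adj.unit.app X.obj ≫ 𝟙 _ ≫ T.map (𝟙 _) ≫ 𝟙 _ ≫ 𝟙 _ ≫ 𝟙 _
    simp
  have : NatTrans.CommShift (Functor.whiskerRight (unitRestrict adj hA hS hT) A₂.ι) M := by
    rw [h]; infer_instance
  exact commShift_of_whiskerRight _ A₂.ι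

end Shift

section

variable {C : Type u₁} [Category.{v₁} C] [HasZeroObject C] [HasShift C ℤ] [Preadditive C]
  [∀ n : ℤ, (shiftFunctor C n).Additive] [Pretriangulated C]
variable {C' : Type u₂} [Category.{v₂} C'] [HasZeroObject C'] [HasShift C' ℤ] [Preadditive C']
  [∀ n : ℤ, (shiftFunctor C' n).Additive] [Pretriangulated C']

/-- The objects at which a natural transformation between triangle functors is invertible form
a thick subcategory. -/
lemma isIso_app_of_thick {P : ObjectProperty C} {F₁ F₂ : (thick P).FullSubcategory ⥤ C'}
    [F₁.CommShift ℤ] [F₁.IsTriangulated] [F₂.CommShift ℤ] [F₂.IsTriangulated] (τ : F₁ ⟶ F₂)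
    [NatTrans.CommShift τ ℤ] (h : ∀ X (hX : P X), IsIso (τ.app ⟨X, le_thick _ _ hX⟩))
    (X : (thick P).FullSubcategory) : IsIso (τ.app X) := by
  -- `R` is shown to be thick; it contains `P`
  let R : ObjectProperty C := fun X => ∃ hX : thick P X, IsIso (τ.app ⟨X, hX⟩)
  have hR₁ : R.IsStableUnderRetracts := ⟨fun {X Y} r hY => by
    obtain ⟨hY, _⟩ := hY
    refine ⟨(thick P).prop_of_retract r hY, ?_⟩
    let r' : Retract (⟨X, (thick P).prop_of_retract r hY⟩ : (thick P).FullSubcategory) ⟨Y, hY⟩ :=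
      ⟨(thick P).homMk r.i, (thick P).homMk r.r, by ext; exact r.retract⟩
    refine MorphismProperty.of_retract (P := .isomorphisms C') (f := τ.app _)
      (g := τ.app ⟨Y, hY⟩) ?_ ‹_›
    exact {
      i := Arrow.homMk (F₁.map r'.i) (F₂.map r'.i) (τ.naturality _)
      r := Arrow.homMk (F₁.map r'.r) (F₂.map r'.r) (τ.naturality _)
      retract := by ext <;> simp [← Functor.map_comp] }⟩
  have hR₂ : R.ContainsZero := ⟨0, isZero_zero C, (thick P).prop_zero, by
    have h0 : IsZero (⟨0, (thick P).prop_zero⟩ : (thick P).FullSubcategory) := by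
      rw [IsZero.iff_id_eq_zero]
      ext
    exact ⟨0, (F₁.map_isZero h0).eq_of_src _ _, (F₂.map_isZero h0).eq_of_src _ _⟩⟩
  have hR₃ : R.IsStableUnderShift ℤ := ⟨fun n => ⟨fun X hX => by
    obtain ⟨hX, _⟩ := hX
    refine R.prop_of_iso (((thick P).ι.commShiftIso n).app ⟨X, hX⟩)
      ⟨ObjectProperty.FullSubcategory.property _, ?_⟩
    change IsIso (τ.app ((⟨X, hX⟩ : (thick P).FullSubcategory)⟦n⟧))
    rw [NatTrans.app_shift τ n ⟨X, hX⟩]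
    infer_instance⟩⟩
  have hR₄ : R.IsTriangulatedClosed₂ := .mk' (fun T hT h₁ h₃ => by
    obtain ⟨h₁, i₁⟩ := h₁
    obtain ⟨h₃, i₃⟩ := h₃
    have h₂ := (thick P).ext_of_isTriangulatedClosed₂ T hT h₁ h₃
    refine ⟨h₂, ?_⟩
    let T' : Triangle (thick P).FullSubcategory :=
      Triangle.mk (X := ⟨T.obj₁, h₁⟩) (Y := ⟨T.obj₂, h₂⟩) (Z := ⟨T.obj₃, h₃⟩)
        ((thick P).homMk T.mor₁) ((thick P).homMk T.mor₂)
        ((thick P).homMk (T.mor₃ ≫ ((thick P).ι.commShiftIso 1).inv.app ⟨T.obj₁, h₁⟩))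
    have hT' : T' ∈ distTriang _ := by
      rw [← (thick P).ι.map_distinguished_iff]
      refine isomorphic_distinguished _ hT _
        (Triangle.isoMk _ _ (Iso.refl _) (Iso.refl _) (Iso.refl _) ?_ ?_ ?_)
      · change T.mor₁ ≫ 𝟙 _ = 𝟙 _ ≫ T.mor₁
        simp
      · change T.mor₂ ≫ 𝟙 _ = 𝟙 _ ≫ T.mor₂
        simp
      · change ((T.mor₃ ≫ ((thick P).ι.commShiftIso (1 : ℤ)).inv.app ⟨T.obj₁, h₁⟩) ≫
          ((thick P).ι.commShiftIso (1 : ℤ)).hom.app ⟨T.obj₁, h₁⟩) ≫ (𝟙 T.obj₁)⟦(1 : ℤ)⟧' =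
            𝟙 _ ≫ T.mor₃
        have e := ((thick P).ι.commShiftIso (1 : ℤ)).inv_hom_id_app ⟨T.obj₁, h₁⟩
        erw [CategoryTheory.Functor.map_id, Category.comp_id, Category.assoc, e,
          Category.comp_id, Category.id_comp]
    let φ : F₁.mapTriangle.obj T' ⟶ F₂.mapTriangle.obj T' :=
      Triangle.homMk _ _ (τ.app _) (τ.app _) (τ.app _) (τ.naturality T'.mor₁)
        (τ.naturality T'.mor₂) (by
        change (F₁.map T'.mor₃ ≫ (F₁.commShiftIso (1 : ℤ)).hom.app T'.obj₁) ≫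
          (τ.app T'.obj₁)⟦(1 : ℤ)⟧' =
            τ.app T'.obj₃ ≫ F₂.map T'.mor₃ ≫ (F₂.commShiftIso (1 : ℤ)).hom.app T'.obj₁
        rw [Category.assoc, NatTrans.shift_app_comm, τ.naturality_assoc])
    exact isIso₂_of_isIso₁₃ φ (F₁.map_distinguished _ hT') (F₂.map_distinguished _ hT') i₁ i₃)
  have : R.IsTriangulated := {}
  exact (thick_le (Q := R) (fun X hX => ⟨le_thick _ _ hX, h X hX⟩) _ X.property).2

/-- If the unit of `S ⊣ T` becomes invertible in `(A₂)_{B₂}` at the objects of `P`, then it does so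
at the objects of `thick P`. -/
lemma isIso_proj_map_unit [IsTriangulated C] {P A₂ B₂ : ObjectProperty C} {A₁ : ObjectProperty C'}
    [A₁.IsTriangulated] [A₂.IsTriangulated] [B₂.IsTriangulated] [B₂.IsClosedUnderIsomorphisms]
    {S : C ⥤ C'} {T : C' ⥤ C} [S.CommShift ℤ] [S.IsTriangulated] (adj : S ⊣ T)
    (hA : thick P ≤ A₂.inverseImage (𝟭 C)) (hS : thick P ≤ A₁.inverseImage S)
    (hT : A₁ ≤ A₂.inverseImage T)
    (h : ∀ X (hX : P X), IsIso ((Verdier.proj A₂ B₂).map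
      ((unitRestrict adj hA hS hT).app ⟨X, le_thick _ _ hX⟩))) (X : (thick P).FullSubcategory) :
    IsIso ((Verdier.proj A₂ B₂).map ((unitRestrict adj hA hS hT).app X)) := by
  -- `T` gets the structure for which the unit is compatible with the shifts
  let := adj.rightAdjointCommShift ℤ
  have := adj.commShift_of_leftAdjoint ℤ
  have := adj.isTriangulated_rightAdjoint
  exact isIso_app_of_thick
    (Functor.whiskerRight (unitRestrict adj hA hS hT) (Verdier.proj A₂ B₂)) h X

section

variable {A A₂ B B₂ : ObjectProperty C} {A₁ B₁ : ObjectProperty C'}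
  [A.IsTriangulated] [A₁.IsTriangulated] [A₂.IsTriangulated]
  [B.IsTriangulated] [B.IsClosedUnderIsomorphisms]
  [B₁.IsTriangulated] [B₁.IsClosedUnderIsomorphisms]
  [B₂.IsTriangulated] [B₂.IsClosedUnderIsomorphisms]
  {S : C ⥤ C'} {T : C' ⥤ C} [S.CommShift ℤ] [S.IsTriangulated]
  [T.CommShift ℤ] [T.IsTriangulated] (adj : S ⊣ T)
  (hA : A ≤ A₂.inverseImage (𝟭 C)) (hB : B ≤ B₂.inverseImage (𝟭 C))
  (hSA : A ≤ A₁.inverseImage S) (hSB : B ≤ B₁.inverseImage S)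
  (hTA : A₁ ≤ A₂.inverseImage T) (hTB : B₁ ≤ B₂.inverseImage T)

/-- The transformation induced by the unit of the adjunction from the functor `A_B ⥤ (A₂)_{B₂}`
given by the inclusion to the one given by `S` and `T`, precomposed with the localisation
functor. -/
noncomputable def projMapUnit :
    Verdier.proj A B ⋙ Verdier.map (𝟭 C) hA hB ⟶
      Verdier.proj A B ⋙ Verdier.map S hSA hSB ⋙ Verdier.map T hTA hTB :=
  (Verdier.projCompMap (𝟭 C) hA hB).hom ≫
  Functor.whiskerRight (unitRestrict adj hA hSA hTA) (Verdier.proj A₂ B₂) ≫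
  (Functor.associator (restrict S A A₁ hSA) (restrict T A₁ A₂ hTA) (Verdier.proj A₂ B₂)).hom ≫
  Functor.whiskerLeft (restrict S A A₁ hSA) (Verdier.projCompMap T hTA hTB).inv ≫
  (Functor.associator (restrict S A A₁ hSA) (Verdier.proj A₁ B₁) (Verdier.map T hTA hTB)).inv ≫
  Functor.whiskerRight (Verdier.projCompMap S hSA hSB).inv (Verdier.map T hTA hTB) ≫
  (Functor.associator (Verdier.proj A B) (Verdier.map S hSA hSB) (Verdier.map T hTA hTB)).hom

instance [adj.CommShift ℤ] : NatTrans.CommShift (projMapUnit adj hA hB hSA hSB hTA hTB) ℤ := by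
  unfold projMapUnit
  iterate 6 refine @NatTrans.CommShift.comp _ _ _ _ _ _ _ _ _ ℤ _ _ _ _ _ _ inferInstance ?_
  infer_instance

/-- If the unit becomes invertible in `(A₂)_{B₂}` at all objects of `A`, the composite of the
functors induced by `S` and `T` is isomorphic to the functor induced by the inclusion. -/
lemma Verdier.exists_iso_map
    (h : ∀ X : A.FullSubcategory, IsIso ((Verdier.proj A₂ B₂).map
      ((unitRestrict adj hA hSA hTA).app X))) :
    ∃ e : Verdier.map S hSA hSB ⋙ Verdier.map T hTA hTB ≅ Verdier.map (𝟭 C) hA hB,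
      adj.CommShift ℤ → NatTrans.CommShift e.hom ℤ := by
  have : IsIso (projMapUnit adj hA hB hSA hSB hTA hTB) := by
    have : IsIso (Functor.whiskerRight (unitRestrict adj hA hSA hTA) (Verdier.proj A₂ B₂)) := by
      rw [NatTrans.isIso_iff_isIso_app]
      exact h
    unfold projMapUnit
    infer_instance
  let e : Verdier.map (𝟭 C) hA hB ≅ Verdier.map S hSA hSB ⋙ Verdier.map T hTA hTB :=
    Localization.liftNatIso (Verdier.proj A B) (B.inverseImage A.ι).trW _ _ _ _
      (asIso (projMapUnit adj hA hB hSA hSB hTA hTB))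
  refine ⟨e.symm, fun _ => ?_⟩
  have h : Functor.whiskerLeft (Verdier.proj A B) e.hom =
      projMapUnit adj hA hB hSA hSB hTA hTB := by
    ext X
    simp only [Functor.whiskerLeft_app]
    refine (Localization.liftNatTrans_app (Verdier.proj A B) (B.inverseImage A.ι).trW _ _ _ _
      (projMapUnit adj hA hB hSA hSB hTA hTB) X).trans ?_
    simp
  have : NatTrans.CommShift (Functor.whiskerLeft (Verdier.proj A B) e.hom) ℤ := by
    rw [h]; infer_instance
  have := commShift_of_whiskerLeft_localization (M := ℤ) (Verdier.proj A B)
    (B.inverseImage A.ι).trW e.hom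
  exact NatTrans.CommShift.of_iso_inv e ℤ

end

end

/-! ### Restricting functors to equivalences between essential images -/

section Generic

lemma map_injective_of_iso {C C' : Type*} [Category* C] [Category* C'] (F : C ⥤ C')
    {X X' Y Y' : C} (e : X ≅ Y) (e' : X' ≅ Y')
    (h : Function.Injective (F.map : (X ⟶ X') → _)) :
    Function.Injective (F.map : (Y ⟶ Y') → _) := by
  intro f g hfg
  rw [← cancel_epi e.hom, ← cancel_mono e'.inv]
  apply h
  simp only [Functor.map_comp, hfg]

lemma map_surjective_of_iso {C C' : Type*} [Category* C] [Category* C'] (F : C ⥤ C')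
    {X X' Y Y' : C} (e : X ≅ Y) (e' : X' ≅ Y')
    (h : Function.Surjective (F.map : (X ⟶ X') → _)) :
    Function.Surjective (F.map : (Y ⟶ Y') → _) := by
  intro f
  obtain ⟨g, hg⟩ := h (F.map e.hom ≫ f ≫ F.map e'.inv)
  refine ⟨e.inv ≫ g ≫ e'.hom, ?_⟩
  simp [hg]

variable {C₁ C₂ C₃ : Type*} [Category* C₁] [Category* C₂] [Category* C₃]

/-- Let `F` and `G` be composable functors whose composite is compared to `K` by `ν`. On the objects
in the image of `p₁`, let `ν` be invertible, `K` fully faithful, and `G` faithful between their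
images under `F`. Then `F` and `G` restrict to equivalences between the essential images. -/
theorem restrict_essImage_isEquivalence {F : C₁ ⥤ C₂} {G : C₂ ⥤ C₃} {K : C₁ ⥤ C₃} (ν : K ⟶ F ⋙ G)
    {I₁ I₂ I₃ : Type*} [Category* I₁] [Category* I₂] [Category* I₃] (p₁ : I₁ ⥤ C₁) (p₂ : I₂ ⥤ C₂)
    (p₃ : I₃ ⥤ C₃) (h₁₂ : ∀ i, ∃ j, Nonempty (F.obj (p₁.obj i) ≅ p₂.obj j))
    (h₂₁ : ∀ j, ∃ i, Nonempty (F.obj (p₁.obj i) ≅ p₂.obj j))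
    (h₁₃ : ∀ i, ∃ k, Nonempty (K.obj (p₁.obj i) ≅ p₃.obj k))
    (h₃₁ : ∀ k, ∃ i, Nonempty (K.obj (p₁.obj i) ≅ p₃.obj k))
    (hν : ∀ i, IsIso (ν.app (p₁.obj i)))
    (hK : ∀ i i', Function.Bijective (K.map : (p₁.obj i ⟶ p₁.obj i') → _))
    (hGF : ∀ i i',
      Function.Injective (G.map : (F.obj (p₁.obj i) ⟶ F.obj (p₁.obj i')) → _)) :
    ∃ (hF : p₁.essImage ≤ p₂.essImage.inverseImage F)
      (hG : p₂.essImage ≤ p₃.essImage.inverseImage G),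
      (restrict F p₁.essImage p₂.essImage hF).IsEquivalence ∧
      (restrict G p₂.essImage p₃.essImage hG).IsEquivalence := by
  let P₁ := p₁.essImage
  let P₂ := p₂.essImage
  let P₃ := p₃.essImage
  have hF : P₁ ≤ P₂.inverseImage F := by
    rintro X ⟨i, ⟨e⟩⟩
    obtain ⟨j, ⟨e'⟩⟩ := h₁₂ i
    exact ⟨j, ⟨e'.symm ≪≫ F.mapIso e⟩⟩
  have hF' : ∀ Y, P₂ Y → ∃ X, P₁ X ∧ Nonempty (F.obj X ≅ Y) := by
    rintro Y ⟨j, ⟨e⟩⟩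
    obtain ⟨i, ⟨e'⟩⟩ := h₂₁ j
    exact ⟨_, p₁.obj_mem_essImage i, ⟨e' ≪≫ e⟩⟩
  have hG : P₂ ≤ P₃.inverseImage G := by
    rintro X ⟨j, ⟨e⟩⟩
    obtain ⟨i, ⟨e'⟩⟩ := h₂₁ j
    obtain ⟨k, ⟨e''⟩⟩ := h₁₃ i
    have := hν i
    exact ⟨k, ⟨e''.symm ≪≫ asIso (ν.app (p₁.obj i)) ≪≫ G.mapIso (e' ≪≫ e)⟩⟩
  have hG' : ∀ Z, P₃ Z → ∃ Y, P₂ Y ∧ Nonempty (G.obj Y ≅ Z) := by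
    rintro Z ⟨k, ⟨e⟩⟩
    obtain ⟨i, ⟨e'⟩⟩ := h₃₁ k
    have := hν i
    exact ⟨_, hF _ (p₁.obj_mem_essImage i), ⟨(asIso (ν.app (p₁.obj i))).symm ≪≫ e' ≪≫ e⟩⟩
  refine ⟨hF, hG, ?_⟩
  have hν' : ∀ X, P₁ X → IsIso (ν.app X) := by
    intro X hX
    obtain ⟨i, ⟨e⟩⟩ := hX
    have := hν i
    have h : ν.app X = K.map e.inv ≫ ν.app (p₁.obj i) ≫ (F ⋙ G).map e.hom := by
      rw [ν.naturality_assoc, ← Functor.map_comp, Iso.inv_hom_id,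
        CategoryTheory.Functor.map_id, Category.comp_id]
    rw [h]; infer_instance
  have hK₁ : ∀ X X', P₁ X → P₁ X' → Function.Injective (K.map : (X ⟶ X') → _) := by
    intro X X' hX hX'
    obtain ⟨i, ⟨e⟩⟩ := hX
    obtain ⟨i', ⟨e'⟩⟩ := hX'
    exact map_injective_of_iso K e e' (hK i i').1
  have hK₂ : ∀ X X', P₁ X → P₁ X' → Function.Surjective (K.map : (X ⟶ X') → _) := by
    intro X X' hX hX'
    obtain ⟨i, ⟨e⟩⟩ := hX
    obtain ⟨i', ⟨e'⟩⟩ := hX'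
    exact map_surjective_of_iso K e e' (hK i i').2
  have hGF' : ∀ X X', P₁ X → P₁ X' → Function.Injective (G.map : (F.obj X ⟶ F.obj X') → _) := by
    intro X X' hX hX'
    obtain ⟨i, ⟨e⟩⟩ := hX
    obtain ⟨i', ⟨e'⟩⟩ := hX'
    exact map_injective_of_iso G (F.mapIso e) (F.mapIso e') (hGF i i')
  -- `ν` identifies `G (F f)` with `K f`
  have hFG₁ : ∀ X X' (hX : P₁ X) (hX' : P₁ X') (h : G.obj (F.obj X) ⟶ G.obj (F.obj X')),
      ∃ f : X ⟶ X', G.map (F.map f) = h := by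
    intro X X' hX hX' h
    have := hν' X hX
    have := hν' X' hX'
    obtain ⟨f, hf⟩ := hK₂ X X' hX hX' (ν.app X ≫ h ≫ inv (ν.app X'))
    refine ⟨f, ?_⟩
    have hn := ν.naturality f
    rw [hf] at hn
    rw [← cancel_epi (ν.app X)]
    simpa using hn.symm
  have hFG₂ : ∀ X X' (hX : P₁ X) (hX' : P₁ X') (f g : X ⟶ X'),
      G.map (F.map f) = G.map (F.map g) → f = g := by
    intro X X' hX hX' f g hfg
    have := hν' X' hX'
    apply hK₁ X X' hX hX'
    rw [← cancel_mono (ν.app X'), ν.naturality, ν.naturality]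
    exact congrArg (ν.app X ≫ ·) hfg
  have : (restrict F P₁ P₂ hF).Faithful := ⟨fun {X Y} f g h => by
    ext
    exact hFG₂ _ _ X.property Y.property _ _
      (congrArg G.map (congrArg (P₂.ι).map h))⟩
  have : (restrict F P₁ P₂ hF).Full := ⟨fun {X Y} h => by
    obtain ⟨f, hf⟩ := hFG₁ _ _ X.property Y.property (G.map h.hom)
    exact ⟨P₁.homMk f, by ext; exact hGF' _ _ X.property Y.property hf⟩⟩
  have : (restrict F P₁ P₂ hF).EssSurj := ⟨fun Y => by
    obtain ⟨X, hX, ⟨e⟩⟩ := hF' _ Y.property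
    exact ⟨⟨X, hX⟩, ⟨P₂.isoMk e⟩⟩⟩
  have h₁ : (restrict F P₁ P₂ hF).IsEquivalence := {}
  have : (restrict F P₁ P₂ hF ⋙ restrict G P₂ P₃ hG).Faithful := ⟨fun {X Y} f g h => by
    ext
    exact hFG₂ _ _ X.property Y.property _ _ (congrArg (P₃.ι).map h)⟩
  have : (restrict F P₁ P₂ hF ⋙ restrict G P₂ P₃ hG).Full := ⟨fun {X Y} h => by
    obtain ⟨f, hf⟩ := hFG₁ _ _ X.property Y.property h.hom
    exact ⟨P₁.homMk f, by ext; exact hf⟩⟩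
  have : (restrict G P₂ P₃ hG).EssSurj := ⟨fun Y => by
    obtain ⟨X, hX, ⟨e⟩⟩ := hG' _ Y.property
    exact ⟨⟨X, hX⟩, ⟨P₃.isoMk e⟩⟩⟩
  have : (restrict F P₁ P₂ hF ⋙ restrict G P₂ P₃ hG).IsEquivalence := { }
  exact ⟨h₁, Functor.isEquivalence_of_comp_left (restrict F P₁ P₂ hF) _⟩

end Generic

/-! ### Refinement of denominators -/

section Refine

variable {C : Type u₁} [Category.{v₁} C] [HasZeroObject C] [HasShift C ℤ] [Preadditive C]
  [∀ n : ℤ, (shiftFunctor C n).Additive] [Pretriangulated C]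
variable {C' : Type u₂} [Category.{v₂} C'] [HasZeroObject C'] [HasShift C' ℤ] [Preadditive C']
  [∀ n : ℤ, (shiftFunctor C' n).Additive] [Pretriangulated C']

/-- If every morphism from `Φ X` to an object of `B'` factors through the image of a morphism from
`X` to an object of `B`, then the morphisms to `X` with cone in `B` are cofinal among the morphisms
to `Φ X` with cone in `B'`. -/
lemma exists_refinement (Φ : C ⥤ C') [Φ.CommShift ℤ] [Φ.IsTriangulated] {B : ObjectProperty C}
    {B' : ObjectProperty C'} {X : C}
    (hX : ∀ ⦃W' : C'⦄ (g : Φ.obj X ⟶ W'), B' W' →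
      ∃ (W : C) (a : X ⟶ W) (d : Φ.obj W ⟶ W'), B W ∧ g = Φ.map a ≫ d)
    {X₁ : C'} (s : X₁ ⟶ Φ.obj X) (hs : B'.trW s) :
    ∃ (X' : C) (s' : X' ⟶ X) (u : Φ.obj X' ⟶ X₁), B.trW s' ∧ u ≫ s = Φ.map s' := by
  obtain ⟨W', g, h, hT, hW'⟩ := hs
  obtain ⟨W, a, d, hW, rfl⟩ := hX g hW'
  obtain ⟨X', s', k, hT'⟩ := distinguished_cocone_triangle₁ a
  obtain ⟨u, hu⟩ := Triangle.coyoneda_exact₂ _ hT (Φ.map s') (by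
    change Φ.map s' ≫ Φ.map a ≫ d = 0
    have h0 : s' ≫ a = 0 := comp_distTriang_mor_zero₁₂ _ hT'
    rw [← Functor.map_comp_assoc, h0, Functor.map_zero, zero_comp])
  exact ⟨X', s', u, ⟨W, a, k, hT', hW⟩, hu.symm⟩

/-- A fully faithful triangle functor `Φ` induces an injection on the morphisms with source `X`
between the localisations, provided that denominators over `Φ X` can be refined by denominators
over `X`. -/
lemma localizedFunctor_map_injective [IsTriangulated C] [IsTriangulated C']
    {D₁ D₂ : Type*} [Category* D₁] [Category* D₂] [Preadditive D₁] [Preadditive D₂]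
    (Φ : C ⥤ C') [Φ.CommShift ℤ] [Φ.IsTriangulated] [Φ.Full] [Φ.Faithful] {B : ObjectProperty C}
    {B' : ObjectProperty C'} [B.IsTriangulated] [B'.IsTriangulated]
    (hΦ : ∀ ⦃X Y : C⦄ (f : X ⟶ Y), B.trW f → B'.trW (Φ.map f))
    (L₁ : C ⥤ D₁) (L₂ : C' ⥤ D₂) [L₁.IsLocalization B.trW] [L₂.IsLocalization B'.trW]
    [L₁.Additive] [L₂.Additive]
    (K : D₁ ⥤ D₂) [K.Additive] (e : L₁ ⋙ K ≅ Φ ⋙ L₂) {X : C}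
    (hX : ∀ ⦃W' : C'⦄ (g : Φ.obj X ⟶ W'), B' W' →
      ∃ (W : C) (a : X ⟶ W) (d : Φ.obj W ⟶ W'), B W ∧ g = Φ.map a ≫ d)
    (Y : C) :
    Function.Injective (K.map : (L₁.obj X ⟶ L₁.obj Y) → _) := by
  intro α β hαβ
  rw [← sub_eq_zero] at hαβ ⊢
  rw [← K.map_sub] at hαβ
  generalize α - β = γ at hαβ ⊢
  obtain ⟨φ, rfl⟩ := Localization.exists_rightFraction L₁ B.trW γ
  have hs := MorphismProperty.RightFraction.map_s_comp_map φ L₁ (Localization.inverts L₁ B.trW)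
  generalize φ.map L₁ (Localization.inverts L₁ B.trW) = γ at hαβ hs ⊢
  have h₁ : L₂.map (Φ.map φ.f) = L₂.map 0 := by
    have := e.hom.naturality φ.f
    dsimp at this
    rw [← hs, Functor.map_comp, hαβ, comp_zero, zero_comp] at this
    rw [Functor.map_zero, ← cancel_epi (e.hom.app _), ← this, comp_zero]
  rw [MorphismProperty.map_eq_iff_precomp L₂ B'.trW] at h₁
  obtain ⟨X₂, t, ht, ht'⟩ := h₁
  obtain ⟨X', s', u, hs', hu⟩ := exists_refinement Φ hX (t ≫ Φ.map φ.s)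
    (B'.trW.comp_mem _ _ ht (hΦ _ φ.hs))
  obtain ⟨v, hv⟩ := Φ.map_surjective (u ≫ t)
  have hvs : v ≫ φ.s = s' := Φ.map_injective (by simp [hv, ← hu])
  have hvf : v ≫ φ.f = 0 := Φ.map_injective (by simp [hv, ht'])
  have := Localization.inverts L₁ B.trW _ hs'
  rw [← cancel_epi (L₁.map s'), comp_zero, ← hvs, L₁.map_comp, Category.assoc, hs, ← L₁.map_comp,
    hvf, L₁.map_zero]

/-- A full triangle functor `Φ` induces a surjection on the morphisms with source `X` between the
localisations, provided that denominators over `Φ X` can be refined by denominators over `X`. -/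
lemma localizedFunctor_map_surjective [IsTriangulated C']
    {D₁ D₂ : Type*} [Category* D₁] [Category* D₂]
    (Φ : C ⥤ C') [Φ.CommShift ℤ] [Φ.IsTriangulated] [Φ.Full] {B : ObjectProperty C}
    {B' : ObjectProperty C'} [B'.IsTriangulated]
    (L₁ : C ⥤ D₁) (L₂ : C' ⥤ D₂) [L₁.IsLocalization B.trW] [L₂.IsLocalization B'.trW]
    (K : D₁ ⥤ D₂) (e : L₁ ⋙ K ≅ Φ ⋙ L₂) {X : C}
    (hX : ∀ ⦃W' : C'⦄ (g : Φ.obj X ⟶ W'), B' W' →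
      ∃ (W : C) (a : X ⟶ W) (d : Φ.obj W ⟶ W'), B W ∧ g = Φ.map a ≫ d)
    (Y : C) :
    Function.Surjective (K.map : (L₁.obj X ⟶ L₁.obj Y) → _) := by
  intro β
  obtain ⟨φ, hφ⟩ := Localization.exists_rightFraction L₂ B'.trW (e.inv.app X ≫ β ≫ e.hom.app Y)
  have hs := MorphismProperty.RightFraction.map_s_comp_map φ L₂ (Localization.inverts L₂ B'.trW)
  rw [← hφ] at hs
  obtain ⟨X', s', u, hs', hu⟩ := exists_refinement Φ hX φ.s φ.hs
  obtain ⟨f, hf⟩ := Φ.map_surjective (u ≫ φ.f)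
  have := Localization.inverts L₁ B.trW _ hs'
  refine ⟨inv (L₁.map s') ≫ L₁.map f, ?_⟩
  have n₁ := e.hom.naturality f
  have n₂ := e.hom.naturality s'
  dsimp at n₁ n₂
  rw [K.map_comp, Functor.map_inv, IsIso.inv_comp_eq, ← cancel_mono (e.hom.app Y), n₁, hf,
    L₂.map_comp, ← hs, ← Functor.map_comp_assoc, hu, ← reassoc_of% n₂]
  simp

end Refine

/-! ### Morphisms with source in the image of the left adjoint -/

section Adj

variable {C : Type u₁} [Category.{v₁} C] [Preadditive C] {C' : Type u₂} [Category.{v₂} C']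
  [Preadditive C']

/-- A morphism in `A₁` with source `S X` vanishes if its adjunct vanishes. -/
lemma eq_zero_of_unitRestrict_comp {S : C ⥤ C'} {T : C' ⥤ C} [S.Additive] (adj : S ⊣ T)
    {A A₂ : ObjectProperty C} {A₁ : ObjectProperty C'} (hA : A ≤ A₂.inverseImage (𝟭 C))
    (hS : A ≤ A₁.inverseImage S) (hT : A₁ ≤ A₂.inverseImage T) {X : A.FullSubcategory}
    {W : A₁.FullSubcategory} (f : (restrict S A A₁ hS).obj X ⟶ W)
    (hf : (unitRestrict adj hA hS hT).app X ≫ (restrict T A₁ A₂ hT).map f = 0) : f = 0 := by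
  ext
  apply (adj.homEquiv _ _).injective
  have h : adj.unit.app X.obj ≫ T.map f.hom = 0 := congrArg A₂.ι.map hf
  rw [Adjunction.homEquiv_unit]
  refine h.trans ?_
  have := adj.right_adjoint_additive
  rw [Adjunction.homEquiv_unit]
  erw [T.map_zero, comp_zero]

end Adj

section Quot

variable {C : Type u₁} [Category.{v₁} C] [Preadditive C]

/-- A split monomorphism whose complementary idempotent factors through `B` becomes invertible
modulo `B`. -/
lemma AddQuot.isIso_proj_map {A B : ObjectProperty C}
    {X Z : A.FullSubcategory} (f : X ⟶ Z) (r : Z.obj ⟶ X.obj) (hr : f.hom ≫ r = 𝟙 X.obj)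
    {W : C} (hW : B W) (a : Z.obj ⟶ W) (b : W ⟶ Z.obj) (h : 𝟙 Z.obj - r ≫ f.hom = a ≫ b) :
    IsIso ((AddQuot.proj A B).map f) := by
  refine ⟨(AddQuot.proj A B).map (A.homMk r), ?_, ?_⟩
  · rw [← Functor.map_comp, ← CategoryTheory.Functor.map_id]
    congr 1
    ext
    exact hr
  · rw [← Functor.map_comp, ← CategoryTheory.Functor.map_id]
    exact (CategoryTheory.Quotient.sound (factorRel A B) ⟨W, hW, a, b, h⟩).symm

variable [HasFiniteBiproducts C]

/-- If every morphism from `X` to an object of `B₂` factors through an object of `B`, then `A / B`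
and `A₂ / B₂` have the same morphisms with source `X`. -/
lemma AddQuot.map_id_bijective {A A₂ B B₂ : ObjectProperty C} [B.IsClosedUnderFiniteProducts]
    [B₂.IsClosedUnderFiniteProducts] (hA : A ≤ A₂.inverseImage (𝟭 C))
    (hB : B ≤ B₂.inverseImage (𝟭 C)) (X V : A.FullSubcategory)
    (hX : ∀ ⦃W : C⦄ (f : X.obj ⟶ W), B₂ W →
      ∃ (W' : C) (a : X.obj ⟶ W') (b : W' ⟶ W), B W' ∧ f = a ≫ b) :
    Function.Bijective ((AddQuot.map (𝟭 C) hA hB).map :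
      ((AddQuot.proj A B).obj X ⟶ (AddQuot.proj A B).obj V) → _) := by
  refine ⟨fun f g hfg => ?_, fun h => ?_⟩
  · obtain ⟨f, rfl⟩ := (AddQuot.proj A B).map_surjective f
    obtain ⟨g, rfl⟩ := (AddQuot.proj A B).map_surjective g
    obtain ⟨W, hW, a, b, h⟩ := (CategoryTheory.Quotient.functor_map_eq_iff (factorRel A₂ B₂)
      ((restrict (𝟭 C) A A₂ hA).map f) ((restrict (𝟭 C) A A₂ hA).map g)).1 hfg
    obtain ⟨W', a', b', hW', rfl⟩ := hX a hW
    exact CategoryTheory.Quotient.sound _ ⟨W', hW', a', b' ≫ b, h.trans (Category.assoc _ _ _)⟩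
  · obtain ⟨h, rfl⟩ := (AddQuot.proj A₂ B₂).map_surjective h
    exact ⟨(AddQuot.proj A B).map (A.homMk h.hom), rfl⟩

/-- By adjunction, a morphism with source `S X` whose image under `T` factors through `B₂` already
factors through `B₁`. -/
lemma AddQuot.map_rightAdjoint_injective {C' : Type u₂} [Category.{v₂} C'] [Preadditive C']
    [HasFiniteBiproducts C'] {S : C ⥤ C'} {T : C' ⥤ C} [S.Additive] [T.Additive]
    (adj : S ⊣ T) {A₁ B₁ : ObjectProperty C'} {A₂ B₂ B : ObjectProperty C}
    [B₁.IsClosedUnderFiniteProducts] [B₂.IsClosedUnderFiniteProducts]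
    (hA : A₁ ≤ A₂.inverseImage T) (hB : B₁ ≤ B₂.inverseImage T) (hSB : B ≤ B₁.inverseImage S)
    (X : C) (hSX : A₁ (S.obj X)) (V : A₁.FullSubcategory)
    (hX : ∀ ⦃W : C⦄ (f : X ⟶ W), B₂ W →
      ∃ (W' : C) (a : X ⟶ W') (b : W' ⟶ W), B W' ∧ f = a ≫ b) :
    Function.Injective ((AddQuot.map T hA hB).map :
      ((AddQuot.proj A₁ B₁).obj ⟨S.obj X, hSX⟩ ⟶ (AddQuot.proj A₁ B₁).obj V) → _) := by
  intro f g hfg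
  obtain ⟨f, rfl⟩ := (AddQuot.proj A₁ B₁).map_surjective f
  obtain ⟨g, rfl⟩ := (AddQuot.proj A₁ B₁).map_surjective g
  obtain ⟨W, hW, a, b, h⟩ := (CategoryTheory.Quotient.functor_map_eq_iff (factorRel A₂ B₂)
    ((restrict T A₁ A₂ hA).map f) ((restrict T A₁ A₂ hA).map g)).1 hfg
  change T.map f.hom - T.map g.hom = a ≫ b at h
  obtain ⟨W', a', b', hW', h'⟩ := hX (adj.unit.app X ≫ a) hW
  refine CategoryTheory.Quotient.sound _
    ⟨S.obj W', hSB _ hW', S.map a', (adj.homEquiv _ _).symm (b' ≫ b), ?_⟩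
  apply (adj.homEquiv _ _).injective
  rw [adj.homEquiv_naturality_left, Equiv.apply_symm_apply, ← Category.assoc, ← h', Category.assoc,
    ← h, ← T.map_sub, adj.homEquiv_unit]

end Quot

lemma exists_factorization_restrict_id {C : Type u₁} [Category.{v₁} C]
    {A A₂ B B₂ : ObjectProperty C} (hBA : B ≤ A) (hA : A ≤ A₂.inverseImage (𝟭 C))
    (X : A.FullSubcategory)
    (hX : ∀ ⦃W : C⦄ (f : X.obj ⟶ W), B₂ W →
      ∃ (W' : C) (a : X.obj ⟶ W') (b : W' ⟶ W), B W' ∧ f = a ≫ b)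
    ⦃W' : A₂.FullSubcategory⦄ (g : (restrict (𝟭 C) A A₂ hA).obj X ⟶ W')
    (hW' : (B₂.inverseImage A₂.ι) W') :
    ∃ (W : A.FullSubcategory) (a : X ⟶ W) (d : (restrict (𝟭 C) A A₂ hA).obj W ⟶ W'),
      (B.inverseImage A.ι) W ∧ g = (restrict (𝟭 C) A A₂ hA).map a ≫ d := by
  obtain ⟨W, a, d, hW, h⟩ := hX g.hom hW'
  exact ⟨⟨W, hBA _ hW⟩, A.homMk a, A₂.homMk d, hW, by ext; exact h⟩

section Verd

variable {C : Type u₁} [Category.{v₁} C] [HasZeroObject C] [HasShift C ℤ] [Preadditive C]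
  [∀ n : ℤ, (shiftFunctor C n).Additive] [Pretriangulated C] [IsTriangulated C]
variable {C' : Type u₂} [Category.{v₂} C'] [HasZeroObject C'] [HasShift C' ℤ] [Preadditive C']
  [∀ n : ℤ, (shiftFunctor C' n).Additive] [Pretriangulated C'] [IsTriangulated C']
variable {A A₂ B B₂ : ObjectProperty C} {A₁ B₁ : ObjectProperty C'}
  [A.IsTriangulated] [A₁.IsTriangulated] [A₂.IsTriangulated]
  [B₁.IsTriangulated] [B₁.IsClosedUnderIsomorphisms]
  [B₂.IsTriangulated] [B₂.IsClosedUnderIsomorphisms]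

instance [B.IsTriangulated] [B.IsClosedUnderIsomorphisms] (F : C ⥤ C') [F.CommShift ℤ]
    [F.IsTriangulated] (hA : A ≤ A₁.inverseImage F)
    (hB : B ≤ B₁.inverseImage F) : (Verdier.map F hA hB).Additive :=
  (Localization.functor_additive_iff (Verdier.proj A B) (B.inverseImage A.ι).trW _).2
    (Functor.additive_of_iso (Verdier.projCompMap F hA hB).symm)

/-- If every morphism from `X` to an object of `B₂` factors through an object of `B`, then `A_B`
and `(A₂)_{B₂}` have the same morphisms with source `X`. -/
lemma Verdier.map_id_bijective [B.IsTriangulated] [B.IsClosedUnderIsomorphisms]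
    (hBA : B ≤ A) (hA : A ≤ A₂.inverseImage (𝟭 C))
    (hB : B ≤ B₂.inverseImage (𝟭 C)) (X V : A.FullSubcategory)
    (hX : ∀ ⦃W : C⦄ (f : X.obj ⟶ W), B₂ W →
      ∃ (W' : C) (a : X.obj ⟶ W') (b : W' ⟶ W), B W' ∧ f = a ≫ b) :
    Function.Bijective ((Verdier.map (𝟭 C) hA hB).map :
      ((Verdier.proj A B).obj X ⟶ (Verdier.proj A B).obj V) → _) := by
  have : (restrict (𝟭 C) A A₂ hA).Faithful := ⟨fun h => by
    ext
    exact congrArg (A₂.ι).map h⟩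
  have : (restrict (𝟭 C) A A₂ hA).Full := ⟨fun f => ⟨A.homMk f.hom, rfl⟩⟩
  have hX' := exists_factorization_restrict_id hBA hA X hX
  have hΦ := (Verdier.localizerMorphism (𝟭 C) hA hB).map
  exact ⟨localizedFunctor_map_injective (restrict (𝟭 C) A A₂ hA) (fun _ _ f hf => hΦ f hf) _ _ _
      (Verdier.projCompMap (𝟭 C) hA hB) hX' V,
    localizedFunctor_map_surjective (restrict (𝟭 C) A A₂ hA) _ _ _
      (Verdier.projCompMap (𝟭 C) hA hB) hX' V⟩

/-- The functor induced by `T` is faithful on the morphisms with source `S X`: write such a morphism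
as a fraction whose denominator comes from `A`, and refine the denominator until the adjunct of the
numerator vanishes. -/
lemma Verdier.map_rightAdjoint_injective {S : C ⥤ C'} {T : C' ⥤ C} [S.CommShift ℤ]
    [S.IsTriangulated] [T.CommShift ℤ] [T.IsTriangulated] (adj : S ⊣ T)
    (hBA : B ≤ A) (hA : A ≤ A₂.inverseImage (𝟭 C)) (hB : B ≤ B₂.inverseImage (𝟭 C))
    (hSA : A ≤ A₁.inverseImage S) (hSB : B ≤ B₁.inverseImage S)
    (hTA : A₁ ≤ A₂.inverseImage T) (hTB : B₁ ≤ B₂.inverseImage T)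
    (X : A.FullSubcategory) (V : A₁.FullSubcategory)
    (hX : ∀ ⦃W : C⦄ (f : X.obj ⟶ W), B₂ W →
      ∃ (W' : C) (a : X.obj ⟶ W') (b : W' ⟶ W), B W' ∧ f = a ≫ b) :
    Function.Injective ((Verdier.map T hTA hTB).map :
      ((Verdier.proj A₁ B₁).obj ((restrict S A A₁ hSA).obj X) ⟶ (Verdier.proj A₁ B₁).obj V) →
        _) := by
  intro α β hαβ
  rw [← sub_eq_zero] at hαβ ⊢
  rw [← (Verdier.map T hTA hTB).map_sub] at hαβ
  generalize α - β = γ at hαβ ⊢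
  obtain ⟨φ, rfl⟩ := Localization.exists_rightFraction (Verdier.proj A₁ B₁)
    (B₁.inverseImage A₁.ι).trW γ
  have hs := MorphismProperty.RightFraction.map_s_comp_map φ (Verdier.proj A₁ B₁)
    (Localization.inverts _ (B₁.inverseImage A₁.ι).trW)
  generalize φ.map (Verdier.proj A₁ B₁) (Localization.inverts _ (B₁.inverseImage A₁.ι).trW) = γ
    at hαβ hs ⊢
  -- the numerator is annihilated by `T`
  have h₁ : (Verdier.proj A₂ B₂).map ((restrict T A₁ A₂ hTA).map φ.f) = 0 := by
    have := (Verdier.projCompMap T hTA hTB).hom.naturality φ.f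
    dsimp only [Functor.comp_map] at this
    rw [← hs, Functor.map_comp, hαβ, comp_zero, zero_comp] at this
    rw [← cancel_epi ((Verdier.projCompMap T hTA hTB).hom.app _), ← this, comp_zero]
  -- the denominator may be chosen in the image of `S`
  obtain ⟨X₁, s, u, hs₁, hu⟩ := exists_refinement (restrict S A A₁ hSA)
    (B := B.inverseImage A.ι) (B' := B₁.inverseImage A₁.ι) (X := X) (fun W' g hW' => by
      obtain ⟨W, a, d, hW, h⟩ := hX (adj.unit.app X.obj ≫ T.map g.hom) (hTB _ hW')
      refine ⟨⟨W, hBA _ hW⟩, A.homMk a, A₁.homMk ((adj.homEquiv _ _).symm d), hW, ?_⟩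
      ext
      apply (adj.homEquiv _ _).injective
      exact ((adj.homEquiv_unit _ _ _).trans h).trans
        (by erw [adj.homEquiv_naturality_left, Equiv.apply_symm_apply]; rfl)) φ.s φ.hs
  have h₂ : (Verdier.proj A₂ B₂).map ((unitRestrict adj hA hSA hTA).app X₁ ≫
      (restrict T A₁ A₂ hTA).map (u ≫ φ.f)) = (Verdier.proj A₂ B₂).map 0 := by
    rw [Functor.map_comp, Functor.map_comp, Functor.map_comp, h₁, comp_zero, comp_zero,
      Functor.map_zero]
  rw [MorphismProperty.map_eq_iff_precomp _ (B₂.inverseImage A₂.ι).trW] at h₂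
  obtain ⟨X₂, t, ht, ht'⟩ := h₂
  have hs₂ : (B₂.inverseImage A₂.ι).trW ((restrict (𝟭 C) A A₂ hA).map s) :=
    (Verdier.localizerMorphism (𝟭 C) hA hB).map _ hs₁
  obtain ⟨X', s', v, hs', hv⟩ := exists_refinement (restrict (𝟭 C) A A₂ hA)
    (exists_factorization_restrict_id hBA hA X hX) (t ≫ (restrict (𝟭 C) A A₂ hA).map s)
    ((B₂.inverseImage A₂.ι).trW.comp_mem _ _ ht hs₂)
  let w : X' ⟶ X₁ := A.homMk (v ≫ t).hom
  have hw : (restrict (𝟭 C) A A₂ hA).map w = v ≫ t := rfl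
  have hws : w ≫ s = s' := by
    ext
    exact congrArg (A₂.ι).map ((Category.assoc _ _ _).trans hv)
  have h₃ : (restrict S A A₁ hSA).map w ≫ u ≫ φ.f = 0 := by
    refine eq_zero_of_unitRestrict_comp adj hA hSA hTA _ ?_
    rw [Functor.map_comp]
    have := (unitRestrict adj hA hSA hTA).naturality_assoc w
      ((restrict T A₁ A₂ hTA).map (u ≫ φ.f))
    refine this.symm.trans ?_
    rw [hw, Category.assoc, ht', comp_zero, comp_zero]
  have : IsIso ((Verdier.proj A₁ B₁).map ((restrict S A A₁ hSA).map s')) :=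
    Localization.inverts _ (B₁.inverseImage A₁.ι).trW _
      ((Verdier.localizerMorphism S hSA hSB).map _ hs')
  rw [← cancel_epi ((Verdier.proj A₁ B₁).map ((restrict S A A₁ hSA).map s')), comp_zero, ← hws,
    Functor.map_comp, ← hu, Functor.map_comp, Functor.map_comp, Category.assoc, Category.assoc, hs,
    ← Functor.map_comp, ← Functor.map_comp, h₃, Functor.map_zero]

end Verd

/-! ### Equivalences between the images in the quotients -/

section Quot

variable {C : Type u₁} [Category.{v₁} C] [Preadditive C] [HasFiniteBiproducts C]
  {C' : Type u₂} [Category.{v₂} C'] [Preadditive C'] [HasFiniteBiproducts C']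

/-- The morphism of functors between additive quotients induced by the unit of an adjunction. -/
def AddQuot.mapUnit {S : C ⥤ C'} {T : C' ⥤ C} [S.Additive] [T.Additive] (adj : S ⊣ T)
    {A A₂ B B₂ : ObjectProperty C} {A₁ B₁ : ObjectProperty C'}
    (hA : A ≤ A₂.inverseImage (𝟭 C)) (hB : B ≤ B₂.inverseImage (𝟭 C))
    (hSA : A ≤ A₁.inverseImage S) (hSB : B ≤ B₁.inverseImage S)
    (hTA : A₁ ≤ A₂.inverseImage T) (hTB : B₁ ≤ B₂.inverseImage T) :
    AddQuot.map (𝟭 C) hA hB ⟶ AddQuot.map S hSA hSB ⋙ AddQuot.map T hTA hTB :=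
  CategoryTheory.Quotient.natTransLift (F := AddQuot.map (𝟭 C) hA hB)
    (G := AddQuot.map S hSA hSB ⋙ AddQuot.map T hTA hTB) _
    (Functor.whiskerRight (unitRestrict adj hA hSA hTA) (AddQuot.proj A₂ B₂))

/-- The functors induced by `S` and `T` restrict to equivalences between the images of `P`, `Q` and
`P` in `A / B`, `A₁ / B₁` and `A₂ / B₂`. -/
theorem AddQuot.restrict_isEquivalence {S : C ⥤ C'} {T : C' ⥤ C} [S.Additive] [T.Additive]
    (adj : S ⊣ T) {A A₂ B B₂ P B₀ : ObjectProperty C} {A₁ B₁ Q B₀' : ObjectProperty C'}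
    [B.IsClosedUnderFiniteProducts] [B₁.IsClosedUnderFiniteProducts]
    [B₂.IsClosedUnderFiniteProducts]
    (hA : A ≤ A₂.inverseImage (𝟭 C)) (hB : B ≤ B₂.inverseImage (𝟭 C))
    (hSA : A ≤ A₁.inverseImage S) (hSB : B ≤ B₁.inverseImage S)
    (hTA : A₁ ≤ A₂.inverseImage T) (hTB : B₁ ≤ B₂.inverseImage T)
    (h₁ : P ≤ A.inverseImage (𝟭 C)) (h₁' : B₀ ≤ B.inverseImage (𝟭 C))
    (h₂ : Q ≤ A₁.inverseImage (𝟭 C')) (h₂' : B₀' ≤ B₁.inverseImage (𝟭 C'))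
    (h₃ : P ≤ A₂.inverseImage (𝟭 C)) (h₃' : B₂ ≤ B₂.inverseImage (𝟭 C))
    (hPQ : ∀ X, P X → Q (S.obj X)) (hQP : ∀ V, Q V → ∃ X, P X ∧ Nonempty (S.obj X ≅ V))
    (hfac : ∀ ⦃X W : C⦄ (f : X ⟶ W), P X → B₂ W →
      ∃ (W' : C) (a : X ⟶ W') (b : W' ⟶ W), B W' ∧ f = a ≫ b)
    (hunit : ∀ X (hX : P X), IsIso ((AddQuot.proj A₂ B₂).map
      ((unitRestrict adj hA hSA hTA).app ⟨X, h₁ X hX⟩))) :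
    ∃ (hF : (AddQuot.map (𝟭 C) h₁ h₁').essImage ≤
          (AddQuot.map (𝟭 C') h₂ h₂').essImage.inverseImage (AddQuot.map S hSA hSB))
      (hG : (AddQuot.map (𝟭 C') h₂ h₂').essImage ≤
          (AddQuot.map (𝟭 C) h₃ h₃').essImage.inverseImage (AddQuot.map T hTA hTB)),
      (restrict (AddQuot.map S hSA hSB) _ _ hF).IsEquivalence ∧
      (restrict (AddQuot.map T hTA hTB) _ _ hG).IsEquivalence :=
  restrict_essImage_isEquivalence (AddQuot.mapUnit adj hA hB hSA hSB hTA hTB) _ _ _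
    (fun i => ⟨⟨⟨S.obj i.as.obj, hPQ _ i.as.property⟩⟩, ⟨Iso.refl _⟩⟩)
    (fun j => by
      obtain ⟨X, hX, ⟨e⟩⟩ := hQP _ j.as.property
      exact ⟨⟨⟨X, hX⟩⟩, ⟨(AddQuot.proj A₁ B₁).mapIso (A₁.isoMk e)⟩⟩)
    (fun i => ⟨⟨i.as⟩, ⟨Iso.refl _⟩⟩)
    (fun k => ⟨⟨k.as⟩, ⟨Iso.refl _⟩⟩)
    (fun i => hunit _ i.as.property)
    (fun i i' => AddQuot.map_id_bijective hA hB ⟨i.as.obj, h₁ _ i.as.property⟩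
      ⟨i'.as.obj, h₁ _ i'.as.property⟩ (fun _ f => hfac f i.as.property))
    (fun i i' => AddQuot.map_rightAdjoint_injective adj hTA hTB hSB i.as.obj
      (hSA _ (h₁ _ i.as.property)) ⟨S.obj i'.as.obj, hSA _ (h₁ _ i'.as.property)⟩
      (fun _ f => hfac f i.as.property))

end Quot

section Verd

variable {C : Type u₁} [Category.{v₁} C] [HasZeroObject C] [HasShift C ℤ] [Preadditive C]
  [∀ n : ℤ, (shiftFunctor C n).Additive] [Pretriangulated C] [IsTriangulated C]
variable {C' : Type u₂} [Category.{v₂} C'] [HasZeroObject C'] [HasShift C' ℤ] [Preadditive C']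
  [∀ n : ℤ, (shiftFunctor C' n).Additive] [Pretriangulated C'] [IsTriangulated C']

/-- The functors induced by `S` and `T` restrict to equivalences between the images of `P`, `Q` and
`P` in the Verdier localisations. -/
theorem Verdier.restrict_isEquivalence {S : C ⥤ C'} {T : C' ⥤ C} [S.CommShift ℤ]
    [S.IsTriangulated] [T.CommShift ℤ] [T.IsTriangulated]
    (adj : S ⊣ T) {A A₂ B B₂ P B₀ : ObjectProperty C} {A₁ B₁ Q B₀' : ObjectProperty C'}
    [A.IsTriangulated] [A₁.IsTriangulated] [A₂.IsTriangulated] [B.IsTriangulated]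
    [B.IsClosedUnderIsomorphisms] [B₁.IsTriangulated] [B₁.IsClosedUnderIsomorphisms]
    [B₂.IsTriangulated] [B₂.IsClosedUnderIsomorphisms]
    (hBA : B ≤ A) (hBA₁ : B₁ ≤ A₁) (hBA₂ : B₂ ≤ A₂)
    (hA : A ≤ A₂.inverseImage (𝟭 C)) (hB : B ≤ B₂.inverseImage (𝟭 C))
    (hSA : A ≤ A₁.inverseImage S) (hSB : B ≤ B₁.inverseImage S)
    (hTA : A₁ ≤ A₂.inverseImage T) (hTB : B₁ ≤ B₂.inverseImage T)
    (h₁ : P ≤ A.inverseImage (𝟭 C)) (h₁' : B₀ ≤ B.inverseImage (𝟭 C))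
    (h₂ : Q ≤ A₁.inverseImage (𝟭 C')) (h₂' : B₀' ≤ B₁.inverseImage (𝟭 C'))
    (h₃ : P ≤ A₂.inverseImage (𝟭 C)) (h₃' : B₂ ≤ B₂.inverseImage (𝟭 C))
    (hPQ : ∀ X, P X → Q (S.obj X)) (hQP : ∀ V, Q V → ∃ X, P X ∧ Nonempty (S.obj X ≅ V))
    (hfac : ∀ ⦃X W : C⦄ (f : X ⟶ W), P X → B₂ W →
      ∃ (W' : C) (a : X ⟶ W') (b : W' ⟶ W), B W' ∧ f = a ≫ b)
    (e : Verdier.map S hSA hSB ⋙ Verdier.map T hTA hTB ≅ Verdier.map (𝟭 C) hA hB) :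
    ∃ (hF : (AddQuot.map (𝟭 C) h₁ h₁' ⋙ canL A B hBA).essImage ≤
          (AddQuot.map (𝟭 C') h₂ h₂' ⋙ canL A₁ B₁ hBA₁).essImage.inverseImage
            (Verdier.map S hSA hSB))
      (hG : (AddQuot.map (𝟭 C') h₂ h₂' ⋙ canL A₁ B₁ hBA₁).essImage ≤
          (AddQuot.map (𝟭 C) h₃ h₃' ⋙ canL A₂ B₂ hBA₂).essImage.inverseImage
            (Verdier.map T hTA hTB)),
      (restrict (Verdier.map S hSA hSB) _ _ hF).IsEquivalence ∧
      (restrict (Verdier.map T hTA hTB) _ _ hG).IsEquivalence :=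
  restrict_essImage_isEquivalence e.inv _ _ _
    (fun i => ⟨⟨⟨S.obj i.as.obj, hPQ _ i.as.property⟩⟩,
      ⟨(canLCompMap S hSA hSB hBA hBA₁).app ((AddQuot.map (𝟭 C) h₁ h₁').obj i)⟩⟩)
    (fun j => by
      obtain ⟨X, hX, ⟨e⟩⟩ := hQP _ j.as.property
      exact ⟨⟨⟨X, hX⟩⟩, ⟨(canLCompMap S hSA hSB hBA hBA₁).app ⟨⟨X, h₁ _ hX⟩⟩ ≪≫
        (Verdier.proj A₁ B₁).mapIso (A₁.isoMk e)⟩⟩)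
    (fun i => ⟨⟨i.as⟩, ⟨(canLCompMap (𝟭 C) hA hB hBA hBA₂).app ⟨⟨i.as.obj, h₁ _ i.as.property⟩⟩⟩⟩)
    (fun k => ⟨⟨k.as⟩, ⟨(canLCompMap (𝟭 C) hA hB hBA hBA₂).app ⟨⟨k.as.obj, h₁ _ k.as.property⟩⟩⟩⟩)
    (fun i => inferInstance)
    (fun i i' => Verdier.map_id_bijective hBA hA hB ⟨i.as.obj, h₁ _ i.as.property⟩
      ⟨i'.as.obj, h₁ _ i'.as.property⟩ (fun _ f => hfac f i.as.property))
    (fun i i' => map_injective_of_iso _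
      ((canLCompMap S hSA hSB hBA hBA₁).symm.app ((AddQuot.map (𝟭 C) h₁ h₁').obj i))
      ((canLCompMap S hSA hSB hBA hBA₁).symm.app ((AddQuot.map (𝟭 C) h₁ h₁').obj i'))
      (Verdier.map_rightAdjoint_injective adj hBA hA hB hSA hSB hTA hTB
        ⟨i.as.obj, h₁ _ i.as.property⟩ ⟨S.obj i'.as.obj, hSA _ (h₁ _ i'.as.property)⟩
        (fun _ f => hfac f i.as.property)))

end Verd

/-! ### Splitting of the unit -/

section Split

/-- A direct summand of an additive functor is additive. -/
lemma additive_of_retract {C C' : Type*} [Category* C] [Preadditive C] [Category* C']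
    [Preadditive C'] {F U : C ⥤ C'} [F.Additive] (r : Retract U F) : U.Additive where
  map_add {X Y f g} := by
    have h : ∀ k : X ⟶ Y, U.map k = r.i.app X ≫ F.map k ≫ r.r.app Y := fun k => by
      rw [r.r.naturality, ← NatTrans.comp_app_assoc, r.retract, NatTrans.id_app,
        Category.id_comp]
    simp only [h, F.map_add, Preadditive.add_comp, Preadditive.comp_add]

variable {C : Type u₁} [Category.{v₁} C] [Preadditive C] [HasBinaryBiproducts C]
  {C' : Type u₂} [Category.{v₂} C']

/-- The unit is split at every object `X`, and the complementary idempotent of `T S X` factors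
through `U X`. -/
lemma exists_retraction_unit {S : C ⥤ C'} {T : C' ⥤ C} (adj : S ⊣ T) {U : C ⥤ C}
    (φ : S ⋙ T ≅ 𝟭 C ⊞ U) (hφ : IsIso (adj.unit ≫ φ.hom ≫ biprod.fst)) (X : C) :
    ∃ (r : T.obj (S.obj X) ⟶ X) (a : T.obj (S.obj X) ⟶ U.obj X) (b : U.obj X ⟶ T.obj (S.obj X)),
      adj.unit.app X ≫ r = 𝟙 X ∧ 𝟙 _ - r ≫ adj.unit.app X = a ≫ b := by
  let θ : 𝟭 C ⟶ 𝟭 C := adj.unit ≫ φ.hom ≫ biprod.fst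
  let ρ : S ⋙ T ⟶ 𝟭 C := φ.hom ≫ biprod.fst ≫ inv θ
  have h₁ : adj.unit ≫ ρ = 𝟙 _ := by
    change adj.unit ≫ φ.hom ≫ biprod.fst ≫ inv θ = _
    have : (adj.unit ≫ φ.hom ≫ biprod.fst) ≫ inv θ = 𝟙 _ := IsIso.hom_inv_id θ
    simpa only [Category.assoc] using this
  have h₂ : 𝟙 _ - ρ ≫ adj.unit =
      ((𝟙 _ - ρ ≫ adj.unit) ≫ φ.hom ≫ biprod.snd) ≫ biprod.inr ≫ φ.inv := by
    -- the component of `𝟙 - ρ ≫ adj.unit` along the first summand vanishes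
    have h₃ : (𝟙 _ - ρ ≫ adj.unit) ≫ φ.hom ≫ biprod.fst = 0 := by
      rw [Preadditive.sub_comp, Category.id_comp, Category.assoc]
      change _ - (φ.hom ≫ biprod.fst ≫ inv θ) ≫ θ = 0
      simp
    calc 𝟙 _ - ρ ≫ adj.unit = (𝟙 _ - ρ ≫ adj.unit) ≫ φ.hom ≫
          (biprod.fst ≫ biprod.inl + biprod.snd ≫ biprod.inr) ≫ φ.inv := by
            rw [biprod.total, Category.id_comp, Iso.hom_inv_id, Category.comp_id]
      _ = _ := by
        simp only [Preadditive.add_comp, Preadditive.comp_add, Category.assoc] at h₃ ⊢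
        rw [reassoc_of% h₃, zero_comp, zero_add]
  exact ⟨ρ.app X, ((𝟙 _ - ρ ≫ adj.unit) ≫ φ.hom ≫ biprod.snd).app X,
    (biprod.inr ≫ φ.inv).app X, congrArg (fun τ => τ.app X) h₁, congrArg (fun τ => τ.app X) h₂⟩

/-- The complementary summand `U` is a retract of `S ⋙ T`. -/
lemma exists_retract {F K U : C ⥤ C} (φ : F ≅ K ⊞ U) : Nonempty (Retract U F) :=
  ⟨⟨biprod.inr ≫ φ.inv, φ.hom ≫ biprod.snd, by simp⟩⟩

end Split

/-! ### Additive functors between the quotients and their images -/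

section Misc

/-- An additive functor with values in the essential image of a fully faithful additive functor `π`
lifts along `π` to an additive functor. -/
lemma exists_lift_of_fullyFaithful {C₁ C₂ C₃ : Type*} [Category* C₁] [Category* C₂] [Category* C₃]
    [Preadditive C₁] [Preadditive C₂] [Preadditive C₃] (F : C₁ ⥤ C₃) [F.Additive]
    (π : C₂ ⥤ C₃) [π.Additive] [π.Full] [π.Faithful] (h : ∀ X, π.essImage (F.obj X)) :
    ∃ K : C₁ ⥤ C₂, K.Additive ∧ Nonempty (K ⋙ π ≅ F) := by
  let e := Functor.essImage.liftFunctorCompIso F π h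
  have := Functor.additive_of_iso e.symm
  exact ⟨Functor.essImage.liftFunctor F π h, Functor.additive_of_comp_faithful _ π, ⟨e⟩⟩

lemma hasFiniteBiproducts_essImage {C₁ C₂ C₃ : Type*} [Category* C₁] [Category* C₂]
    [Category* C₃] [Preadditive C₁] [HasFiniteProducts C₁] [Preadditive C₃] (q : C₁ ⥤ C₂)
    [q.EssSurj] (F : C₂ ⥤ C₃) [(q ⋙ F).Additive] :
    HasFiniteBiproducts F.essImage.FullSubcategory := by
  have : (q ⋙ F.toEssImage).Additive := ⟨fun {X Y f g} => by
    ext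
    exact (q ⋙ F).map_add⟩
  have := Functor.hasFiniteProducts_of_additive_of_essSurj (q ⋙ F.toEssImage)
  exact HasFiniteBiproducts.of_hasFiniteProducts

lemma exists_equivalence_of_comp_iso {C₁ C₂ C₃ : Type*} [Category* C₁] [Category* C₂]
    [Category* C₃] (F : C₁ ⥤ C₂) (G : C₂ ⥤ C₃) {K : C₁ ⥤ C₃} (e : F ⋙ G ≅ K)
    [F.IsEquivalence] [G.IsEquivalence] :
    ∃ E : C₁ ≌ C₃, Nonempty (E.functor ≅ K) ∧ Nonempty (F ⋙ G ⋙ E.inverse ≅ 𝟭 C₁) ∧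
      Nonempty ((G ⋙ E.inverse) ⋙ F ≅ 𝟭 C₂) :=
  ⟨F.asEquivalence.trans G.asEquivalence, ⟨e⟩,
    ⟨(F.asEquivalence.trans G.asEquivalence).unitIso.symm⟩,
    ⟨Functor.isoWhiskerRight (Functor.isoWhiskerRight G.asEquivalence.unitIso.symm
      F.asEquivalence.inverse) F ≪≫ F.asEquivalence.counitIso⟩⟩

lemma restrict_comp_iso {C₁ C₂ C₃ : Type*} [Category* C₁] [Category* C₂]
    [Category* C₃] {F : C₁ ⥤ C₂} {G : C₂ ⥤ C₃} {K : C₁ ⥤ C₃} (e : F ⋙ G ≅ K)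
    {P₁ : ObjectProperty C₁} {P₂ : ObjectProperty C₂} {P₃ : ObjectProperty C₃}
    (hF : P₁ ≤ P₂.inverseImage F) (hG : P₂ ≤ P₃.inverseImage G) (hK : P₁ ≤ P₃.inverseImage K) :
    Nonempty (restrict F P₁ P₂ hF ⋙ restrict G P₂ P₃ hG ≅ restrict K P₁ P₃ hK) :=
  ⟨NatIso.ofComponents (fun X => P₃.isoMk (e.app X.obj)) (fun f => by
    ext
    exact e.hom.naturality f.hom)⟩

lemma AddQuot.map_id_full_faithful {C : Type u₁} [Category.{v₁} C] [Preadditive C]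
    [HasFiniteBiproducts C] {P A B : ObjectProperty C} [B.IsClosedUnderFiniteProducts]
    (h : P ≤ A.inverseImage (𝟭 C)) :
    (AddQuot.map (𝟭 C) h (le_refl B)).Full ∧ (AddQuot.map (𝟭 C) h (le_refl B)).Faithful := by
  have key (X V : P.FullSubcategory) := AddQuot.map_id_bijective h (le_refl B) X V
    (fun W f hW => ⟨W, f, 𝟙 W, hW, (Category.comp_id f).symm⟩)
  exact ⟨⟨fun {X Y} => (key X.as Y.as).2⟩, ⟨fun {X Y} => @(key X.as Y.as).1⟩⟩

instance AddQuot.proj_additive {C : Type u₁} [Category.{v₁} C] [Preadditive C]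
    [HasFiniteBiproducts C] (A B : ObjectProperty C) [B.IsClosedUnderFiniteProducts] :
    (AddQuot.proj A B).Additive :=
  CategoryTheory.Quotient.functor_additive _ (factorRel_add A B)

end Misc

/-! ### The setting of the correspondence -/

section Setting

variable {C : Type u₁} [Category.{v₁} C] [Preadditive C] [HasZeroObject C] [HasShift C ℤ]
  [∀ n : ℤ, (shiftFunctor C n).Additive] [Pretriangulated C]
  {C' : Type u₂} [Category.{v₂} C']

/-- The object `T S X` is a direct summand of `X ⊞ U X`. -/
lemma prop_obj_obj_of_retraction {S : C ⥤ C'} {T : C' ⥤ C} (adj : S ⊣ T) {U : C ⥤ C}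
    (φ : S ⋙ T ≅ 𝟭 C ⊞ U) (hφ : IsIso (adj.unit ≫ φ.hom ≫ biprod.fst)) {P : ObjectProperty C}
    [P.IsTriangulated] [P.IsStableUnderRetracts] {X : C} (hX : P X) (hU : P (U.obj X)) :
    P (T.obj (S.obj X)) := by
  obtain ⟨r, a, b, -, h⟩ := exists_retraction_unit adj φ hφ X
  refine P.prop_of_retract (Y := X ⊞ U.obj X)
    ⟨biprod.lift r a, biprod.desc (adj.unit.app X) b, ?_⟩
    (P.prop_of_isLimit_binaryFan (BinaryBiproduct.isLimit X (U.obj X)) hX hU)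
  rw [biprod.lift_desc, ← h, add_sub_cancel]

/-- A morphism from an object `S' z` to an object `W` of `Y` factors through `S' T' W`, because it
corresponds under the adjunction to a morphism `z ⟶ T' W`. -/
lemma exists_factorization_of_leftAdjoint {S' : C' ⥤ C} {T' : C ⥤ C'} (adj : S' ⊣ T')
    {Z : ObjectProperty C'} {Y : ObjectProperty C} ⦃X W : C⦄ (f : X ⟶ W) (hX : Z.map S' X)
    (hW : Y W) :
    ∃ (W' : C) (a : X ⟶ W') (b : W' ⟶ W), thick (Y.map (T' ⋙ S')) W' ∧ f = a ≫ b := by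
  obtain ⟨z, hz, ⟨e⟩⟩ := hX
  refine ⟨S'.obj (T'.obj W), e.inv ≫ S'.map (adj.homEquiv _ _ (e.hom ≫ f)), adj.counit.app W,
    le_thick _ _ (ObjectProperty.prop_map_obj _ (T' ⋙ S') hW), ?_⟩
  rw [Category.assoc, ← adj.homEquiv_counit, Equiv.symm_apply_apply, Iso.inv_hom_id_assoc]

end Setting

lemma map_map_le {C₁ C₂ C₃ : Type*} [Category* C₁] [Category* C₂] [Category* C₃]
    (P : ObjectProperty C₁) (F : C₁ ⥤ C₂) (G : C₂ ⥤ C₃) :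
    P.map F ≤ (P.map (F ⋙ G)).inverseImage G := by
  rintro _ ⟨X, hX, ⟨e⟩⟩
  exact ⟨X, hX, ⟨G.mapIso e⟩⟩

lemma map_le_of_forall {C₁ C₂ : Type*} [Category* C₁] [Category* C₂] {P : ObjectProperty C₁}
    {F : C₁ ⥤ C₂} {Q : ObjectProperty C₂} [Q.IsClosedUnderIsomorphisms]
    (h : ∀ X, P X → Q (F.obj X)) : P.map F ≤ Q := by
  rintro _ ⟨X, hX, ⟨e⟩⟩
  exact Q.prop_of_iso e (h X hX)

end Green

theorem mainTheorem4
    {D : Type*} [Category* D] [Preadditive D] [HasZeroObject D] [HasShift D ℤ]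
    [∀ n : ℤ, (shiftFunctor D n).Additive] [Pretriangulated D] [IsTriangulated D]
    {H : Type*} [Category* H] [Preadditive H] [HasZeroObject H] [HasShift H ℤ]
    [∀ n : ℤ, (shiftFunctor H n).Additive] [Pretriangulated H] [IsTriangulated H]
    {G : Type*} [Category* G] [Preadditive G] [HasZeroObject G] [HasShift G ℤ]
    [∀ n : ℤ, (shiftFunctor G n).Additive] [Pretriangulated G] [IsTriangulated G]
    (S' : D ⥤ H) [S'.CommShift ℤ] [S'.IsTriangulated]
    (T' : H ⥤ D) [T'.CommShift ℤ] [T'.IsTriangulated]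
    (S : H ⥤ G) [S.CommShift ℤ] [S.IsTriangulated]
    (T : G ⥤ H) [T.CommShift ℤ] [T.IsTriangulated]
    (adj' : S' ⊣ T') (adj : S ⊣ T)
    (U : H ⥤ H) (φ : S ⋙ T ≅ 𝟭 H ⊞ U) (hφ : IsIso (adj.unit ≫ φ.hom ≫ biprod.fst))
    (Y : ObjectProperty H) [Y.IsTriangulated] [Y.IsStableUnderRetracts]
    (hY : ∀ y, Y y → Y.retractClosure (T.obj (S.obj (S'.obj (T'.obj y))))) :
    let Z : ObjectProperty D := Y.retractClosure.inverseImage (S' ⋙ U)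
    let S'Z : ObjectProperty H := Z.map S'
    let SS'Z : ObjectProperty G := Z.map (S' ⋙ S)
    let S'T'Y : ObjectProperty H := Y.map (T' ⋙ S')
    let SS'T'Y : ObjectProperty G := Y.map (T' ⋙ S' ⋙ S)
    let A : ObjectProperty H := Green.thick S'Z
    let B : ObjectProperty H := Green.thick S'T'Y
    let A₁ : ObjectProperty G := Green.thick SS'Z
    let B₁ : ObjectProperty G := Green.thick SS'T'Y
    let A₂ : ObjectProperty H := Green.thick (S'Z ⊔ Y)
    ∃ (hBA : B ≤ A) (hB₁A₁ : B₁ ≤ A₁) (hYA₂ : Y ≤ A₂)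
      (hAA₂ : A ≤ A₂.inverseImage (𝟭 H)) (hBY : B ≤ Y.inverseImage (𝟭 H))
      (hSA : A ≤ A₁.inverseImage S) (hSB : B ≤ B₁.inverseImage S)
      (hTA : A₁ ≤ A₂.inverseImage T) (hTB : B₁ ≤ Y.inverseImage T)
      (hSZ : S'Z ≤ SS'Z.inverseImage S) (hSTY : S'T'Y ≤ SS'T'Y.inverseImage S)
      (h₁ : S'Z ≤ A) (h₁' : S'T'Y ≤ B) (h₂ : SS'Z ≤ A₁) (h₂' : SS'T'Y ≤ B₁) (h₃ : S'Z ≤ A₂),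
      let S_Z : Green.Verdier A B ⥤ Green.Verdier A₁ B₁ := Green.Verdier.map S hSA hSB
      let T_Z : Green.Verdier A₁ B₁ ⥤ Green.Verdier A₂ Y := Green.Verdier.map T hTA hTB
      let can : Green.Verdier A B ⥤ Green.Verdier A₂ Y := Green.Verdier.map (𝟭 H) hAA₂ hBY
      let S_add : Green.AddQuot S'Z S'T'Y ⥤ Green.AddQuot SS'Z SS'T'Y :=
        Green.AddQuot.map S hSZ hSTY
      let S_thick : Green.AddQuot A B ⥤ Green.AddQuot A₁ B₁ := Green.AddQuot.map S hSA hSB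
      let T_thick : Green.AddQuot A₁ B₁ ⥤ Green.AddQuot A₂ Y := Green.AddQuot.map T hTA hTB
      let π₁ : Green.AddQuot S'Z S'T'Y ⥤ Green.AddQuot A B := Green.AddQuot.map (𝟭 H) h₁ h₁'
      let π₂ : Green.AddQuot SS'Z SS'T'Y ⥤ Green.AddQuot A₁ B₁ :=
        Green.AddQuot.map (𝟭 G) h₂ h₂'
      let π₃ : Green.AddQuot S'Z Y ⥤ Green.AddQuot A₂ Y :=
        Green.AddQuot.map (𝟭 H) h₃ (le_refl Y)
      let L₁ : ObjectProperty (Green.Verdier A B) := (π₁ ⋙ Green.canL A B hBA).essImage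
      let L₂ : ObjectProperty (Green.Verdier A₁ B₁) := (π₂ ⋙ Green.canL A₁ B₁ hB₁A₁).essImage
      let L₃ : ObjectProperty (Green.Verdier A₂ Y) := (π₃ ⋙ Green.canL A₂ Y hYA₂).essImage
      -- the commutative triangle of triangle functors
      (S_Z.IsTriangulated ∧ T_Z.IsTriangulated ∧ can.IsTriangulated ∧
        ∃ e : S_Z ⋙ T_Z ≅ can, adj.CommShift ℤ → NatTrans.CommShift e.hom ℤ) ∧
      -- the additive quotients
      (S_add.Additive ∧ S_thick.Additive ∧ T_thick.Additive ∧
        Nonempty (S_add ⋙ π₂ ≅ π₁ ⋙ S_thick) ∧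
        (∃ T_add : Green.AddQuot SS'Z SS'T'Y ⥤ Green.AddQuot S'Z Y,
          T_add.Additive ∧ Nonempty (T_add ⋙ π₃ ≅ π₂ ⋙ T_thick)) ∧
        (∃ h : π₁.essImage ≤ π₂.essImage.inverseImage S_thick,
          (Green.restrict S_thick π₁.essImage π₂.essImage h).IsEquivalence) ∧
        (∃ h : π₂.essImage ≤ π₃.essImage.inverseImage T_thick,
          (Green.restrict T_thick π₂.essImage π₃.essImage h).IsEquivalence)) ∧
      -- the full additive subcategories of the localisations
      (HasFiniteBiproducts L₁.FullSubcategory ∧ HasFiniteBiproducts L₂.FullSubcategory ∧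
        HasFiniteBiproducts L₃.FullSubcategory ∧
        ∃ (hS : L₁ ≤ L₂.inverseImage S_Z) (hT : L₂ ≤ L₃.inverseImage T_Z)
          (hcan : L₁ ≤ L₃.inverseImage can),
          let S_L := Green.restrict S_Z L₁ L₂ hS
          let T_L := Green.restrict T_Z L₂ L₃ hT
          let can_L := Green.restrict can L₁ L₃ hcan
          S_L.Additive ∧ T_L.Additive ∧ S_L.IsEquivalence ∧ T_L.IsEquivalence ∧
            Nonempty (S_L ⋙ T_L ≅ can_L)) ∧
      -- the criterion for triangle equivalences
      (S_thick.IsEquivalence → T_thick.IsEquivalence →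
        S_Z.IsEquivalence ∧ T_Z.IsEquivalence ∧
        ∃ K : Green.Verdier A B ≌ Green.Verdier A₂ Y, Nonempty (K.functor ≅ can) ∧
          Nonempty (S_Z ⋙ T_Z ⋙ K.inverse ≅ 𝟭 (Green.Verdier A B)) ∧
          Nonempty ((T_Z ⋙ K.inverse) ⋙ S_Z ≅ 𝟭 (Green.Verdier A₁ B₁))) := by
  have : HasBinaryBiproducts H := HasBinaryBiproducts.of_hasBinaryProducts
  have : U.Additive := Green.additive_of_retract (Green.exists_retract φ).some
  rw [Y.retractClosure_eq_self] at hY ⊢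
  intro Z S'Z SS'Z S'T'Y SS'T'Y A B A₁ B₁ A₂
  have hZ : Z.IsClosedUnderFiniteProducts := ⟨fun J _ => by
    have : PreservesLimitsOfShape (Discrete J) (S' ⋙ U) := inferInstance
    exact inferInstanceAs
      ((Y.inverseImage (S' ⋙ U)).IsClosedUnderLimitsOfShape (Discrete J))⟩
  -- `U S' T' y` is a direct summand of `T S S' T' y`
  have hTY : ∀ y, Y y → Z (T'.obj y) := fun y hy =>
    Y.prop_of_retract ((Green.exists_retract φ).some.map
      ((evaluation H H).obj (S'.obj (T'.obj y)))) (hY y hy)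
  -- `S' T' y` is a direct summand of `T S S' T' y`
  have hSTY' : ∀ y, Y y → Y (S'.obj (T'.obj y)) := fun y hy => by
    obtain ⟨r, -, -, h, -⟩ := Green.exists_retraction_unit adj φ hφ (S'.obj (T'.obj y))
    exact Y.prop_of_retract ⟨_, r, h⟩ (hY y hy)
  have hP : S'T'Y ≤ S'Z := Green.map_le_of_forall fun y hy => ⟨_, hTY y hy, ⟨Iso.refl _⟩⟩
  have hQ : SS'T'Y ≤ SS'Z := Green.map_le_of_forall fun y hy => ⟨_, hTY y hy, ⟨Iso.refl _⟩⟩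
  have hSZ : S'Z ≤ SS'Z.inverseImage S := Green.map_map_le Z S' S
  have hSTY : S'T'Y ≤ SS'T'Y.inverseImage S := Green.map_map_le Y (T' ⋙ S') S
  have h₁ : S'Z ≤ A := Green.le_thick _
  have h₁' : S'T'Y ≤ B := Green.le_thick _
  have h₂ : SS'Z ≤ A₁ := Green.le_thick _
  have h₂' : SS'T'Y ≤ B₁ := Green.le_thick _
  have h₃ : S'Z ≤ A₂ := le_sup_left.trans (Green.le_thick _)
  have hYA₂ : Y ≤ A₂ := le_sup_right.trans (Green.le_thick _)
  have hBA : B ≤ A := Green.thick_le (hP.trans h₁)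
  have hB₁A₁ : B₁ ≤ A₁ := Green.thick_le (hQ.trans h₂)
  have hAA₂ : A ≤ A₂.inverseImage (𝟭 H) := Green.thick_le h₃
  have hBY : B ≤ Y.inverseImage (𝟭 H) := Green.thick_le (Green.map_le_of_forall hSTY')
  have hSA : A ≤ A₁.inverseImage S := Green.thick_le fun X hX => h₂ _ (hSZ X hX)
  have hSB : B ≤ B₁.inverseImage S := Green.thick_le fun X hX => h₂' _ (hSTY X hX)
  have hTA : A₁ ≤ A₂.inverseImage T := Green.thick_le (Green.map_le_of_forall fun z hz =>
    Green.prop_obj_obj_of_retraction adj φ hφ (h₃ _ ⟨z, hz, ⟨Iso.refl _⟩⟩) (hYA₂ _ hz))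
  have hTB : B₁ ≤ Y.inverseImage T := Green.thick_le (Green.map_le_of_forall hY)
  have hUX : ∀ X, S'Z X → Y (U.obj X) := by
    rintro X ⟨z, hz, ⟨e⟩⟩
    exact Y.prop_of_iso (U.mapIso e) hz
  have hfac := Green.exists_factorization_of_leftAdjoint adj' (Z := Z) (Y := Y)
  have hQP : ∀ V, SS'Z V → ∃ X, S'Z X ∧ Nonempty (S.obj X ≅ V) := by
    rintro V ⟨z, hz, e⟩
    exact ⟨S'.obj z, ⟨z, hz, ⟨Iso.refl _⟩⟩, e⟩
  have hunit : ∀ X (hX : S'Z X), IsIso ((Green.AddQuot.proj A₂ Y).map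
      ((Green.unitRestrict adj hAA₂ hSA hTA).app ⟨X, h₁ X hX⟩)) := fun X hX => by
    obtain ⟨r, a, b, hr, h⟩ := Green.exists_retraction_unit adj φ hφ X
    exact Green.AddQuot.isIso_proj_map _ r hr (hUX X hX) a b h
  obtain ⟨e, he⟩ := Green.Verdier.exists_iso_map adj hAA₂ hBY hSA hSB hTA hTB
    (Green.isIso_proj_map_unit adj hAA₂ hSA hTA fun X hX => by
      have := hunit X hX
      exact Functor.map_isIso (Green.canL A₂ Y hYA₂) ((Green.AddQuot.proj A₂ Y).map
        ((Green.unitRestrict adj hAA₂ hSA hTA).app ⟨X, h₁ X hX⟩)))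
  obtain ⟨hF, hG, hFe, hGe⟩ := Green.AddQuot.restrict_isEquivalence adj hAA₂ hBY hSA hSB hTA hTB
    h₁ h₁' h₂ h₂' h₃ (le_refl Y) hSZ hQP hfac hunit
  obtain ⟨hS, hT, hSe, hTe⟩ := Green.Verdier.restrict_isEquivalence adj hBA hB₁A₁ hYA₂ hAA₂ hBY
    hSA hSB hTA hTB h₁ h₁' h₂ h₂' h₃ (le_refl Y) hSZ hQP hfac e
  refine ⟨hBA, hB₁A₁, hYA₂, hAA₂, hBY, hSA, hSB, hTA, hTB, hSZ, hSTY, h₁, h₁', h₂, h₂', h₃, ?_⟩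
  intro S_Z T_Z can S_add S_thick T_thick π₁ π₂ π₃ L₁ L₂ L₃
  have : π₁.Additive := Green.AddQuot.map_additive (A' := A) (𝟭 H) h₁ h₁'
  have : π₂.Additive := Green.AddQuot.map_additive (A' := A₁) (𝟭 G) h₂ h₂'
  have : π₃.Additive := Green.AddQuot.map_additive (A' := A₂) (𝟭 H) h₃ (le_refl Y)
  have hcan : L₁ ≤ L₃.inverseImage can := fun X hX =>
    L₃.prop_of_iso (e.app X) (hT _ (hS X hX))
  refine ⟨⟨inferInstance, inferInstance, inferInstance, e, he⟩,
    ⟨inferInstance, inferInstance, inferInstance,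
      ⟨CategoryTheory.Quotient.natIsoLift _
        (Iso.refl (Green.AddQuot.proj S'Z S'T'Y ⋙ S_add ⋙ π₂))⟩, ?_, ⟨hF, hFe⟩, ⟨hG, hGe⟩⟩,
    ⟨?_, ?_, ?_, hS, hT, hcan, ?_, ?_, hSe, hTe, Green.restrict_comp_iso e _ _ _⟩, ?_⟩
  -- `π₃` is fully faithful, and `T_thick` maps the image of `π₂` into that of `π₃`
  · obtain ⟨_, _⟩ := Green.AddQuot.map_id_full_faithful (P := S'Z) (A := A₂) (B := Y) h₃
    exact Green.exists_lift_of_fullyFaithful (π₂ ⋙ T_thick) π₃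
      fun X => hG _ (π₂.obj_mem_essImage X)
  · exact Green.hasFiniteBiproducts_essImage (Green.AddQuot.proj S'Z S'T'Y) _
  · exact Green.hasFiniteBiproducts_essImage (Green.AddQuot.proj SS'Z SS'T'Y) _
  · exact Green.hasFiniteBiproducts_essImage (Green.AddQuot.proj S'Z Y) _
  · infer_instance
  · infer_instance
  · intro h h'
    have : S_Z.IsEquivalence := Green.Verdier.map_isEquivalence S hSA hSB hBA hB₁A₁ h
    have : T_Z.IsEquivalence := Green.Verdier.map_isEquivalence T hTA hTB hB₁A₁ hYA₂ h'
    exact ⟨inferInstance, inferInstance, Green.exists_equivalence_of_comp_iso S_Z T_Z e⟩
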